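/- For a finite set $\mathcal{C}$ of subsets (concepts) of a finite set $X$, a labeled example $(x,b)\in X\times\{0,1\}$ is consistent with $C\in\mathcal{C}$ if $b=1\iff x\in C$. A non-clashing teaching map $T$ for $\mathcal{C}$ assigns to every $C\in\mathcal{C}$ a set $T(C)$ of labeled examples consistent with $C$ such that, for all distinct $C,C'\in\mathcal{C}$, some example in $T(C)\cup T(C')$ is consistent with exactly one of $C$ and $C'$; its size is $\max_{C\in\mathcal{C}}|T(C)|$, and $\mathrm{NCTD}(\mathcal{C})$ is the smallest size of such a map. The problem N-NCTD asks, given a finite simple graph $G$, a set $\mathcal{B}$ of closed neighborhoods in $G$ and a positive integer $k$, whether $\mathrm{NCTD}(\mathcal{B})\le k$. (1) Assume the Exponential Time Hypothesis: no deterministic algorithm solves 3-SAT with $n$ variables and $m$ clauses in time $2^{o(n+m)}$. Then for every computable function $f:\mathbb{N}\to\mathbb{N}$, N-NCTD cannot be solved in $2^{o(f(k)\cdot|V(G)|)}$ time, that is, in time $2^{g(f(k)\cdot|V(G)|)}$ with $g(s)=o(s)$, not even if a further factor polynomial in the length of the input is allowed. (2) There is a polynomial-time many-one reduction from 3-SAT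 to N-NCTD that maps every formula with $n$ variables and $m$ clauses to an instance $(G,\mathcal{B},k)$ with $k=1$ and $|V(G)|=O(n+m+1)$. (In this sense N-NCTD is NP-hard already for $k=1$, 3-SAT being NP-complete.) Here algorithms are deterministic Turing machines with finitely many stacks, graphs are given by adjacency matrices, and $k$ is given in binary. -/

import Mathlib

open Filter Asymptotics

namespace NonClash

/-! ## Non-clashing teaching -/

section Teaching

variable {X : Type} [DecidableEq X]

/-- A labeled example `(x, b)` is consistent with a concept `C` if `b` tells correctly whether
`x ∈ C`. -/
def Consistent (e : X × Bool) (C : Finset X) : Prop :=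
  e.2 = true ↔ e.1 ∈ C

/-- A teaching map for the concept class `𝒞`: it sends every concept of `𝒞` to a finite set of
labeled examples that are consistent with it (values outside `𝒞` are irrelevant). -/
def IsTeachingMap (𝒞 : Finset (Finset X)) (T : Finset X → Finset (X × Bool)) : Prop :=
  ∀ C ∈ 𝒞, ∀ e ∈ T C, Consistent e C

/-- The non-clashing condition: for any two distinct concepts, one of the examples used for one of
them is consistent with exactly one of the two. -/
def IsNonClashing (𝒞 : Finset (Finset X)) (T : Finset X → Finset (X × Bool)) : Prop :=
  ∀ C ∈ 𝒞, ∀ D ∈ 𝒞, C ≠ D → ∃ e ∈ T C ∪ T D,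
    (Consistent e C ∧ ¬ Consistent e D) ∨ (Consistent e D ∧ ¬ Consistent e C)

/-- `T` is a non-clashing teaching map of size `k` for `𝒞`. -/
def IsNCTM (𝒞 : Finset (Finset X)) (T : Finset X → Finset (X × Bool)) (k : ℕ) : Prop :=
  IsTeachingMap 𝒞 T ∧ IsNonClashing 𝒞 T ∧ 𝒞.sup (fun C => (T C).card) = k

/-- The non-clashing teaching dimension: the smallest size of a non-clashing teaching map.
(For finite `X` such maps exist: teach every concept by all its consistent examples.) -/
noncomputable def nctd (𝒞 : Finset (Finset X)) : ℕ :=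
  sInf {k | ∃ T, IsNCTM 𝒞 T k}

end Teaching

/-! ## The problem N-NCTD -/

open Classical in
/-- The closed neighborhood `N[v]` of a vertex `v`. -/
noncomputable def closedNbhd {N : ℕ} (G : SimpleGraph (Fin N)) (v : Fin N) : Finset (Fin N) :=
  Finset.univ.filter (fun u => u = v ∨ G.Adj v u)

/-- An instance of N-NCTD: a finite simple graph `G` with vertex set `Fin N`, a set of closed
neighborhoods in `G` (given by a set of vertices whose closed neighborhoods these are), and a
positive integer `k`. -/
structure Instance where
  N : ℕ
  G : SimpleGraph (Fin N)
  centers : Finset (Fin N)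
  k : ℕ
  k_pos : 0 < k

/-- The set `ℬ` of closed neighborhoods of an instance. -/
noncomputable def Instance.concepts (I : Instance) : Finset (Finset (Fin I.N)) :=
  I.centers.image (closedNbhd I.G)

/-- The question of N-NCTD: is `NCTD(ℬ) ≤ k`? -/
def Instance.IsYes (I : Instance) : Prop :=
  nctd I.concepts ≤ I.k

open Classical in
/-- The encoding of an instance as a word over the three-letter alphabet `Option Bool` (`none` is a
separator): `N` in unary, the adjacency matrix row by row, the indicator vector of the centers,
and `k` in binary. -/
noncomputable def Instance.encode (I : Instance) : List (Option Bool) :=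
  List.replicate I.N (some true) ++ [none] ++
  (List.finRange I.N).flatMap
    (fun u => (List.finRange I.N).map (fun v => some (decide (I.G.Adj u v)))) ++
  (List.finRange I.N).map (fun v => some (decide (v ∈ I.centers))) ++ [none] ++
  (Computability.encodeNat I.k).map some

/-! ## 3-SAT -/

/-- A literal over the variables `Fin n`: the variable together with its sign (`true` for the
positive literal). -/
abbrev Literal (n : ℕ) : Type := Fin n × Bool

/-- A 3-SAT formula: a list of clauses of three literals over the variables `Fin numVars`
(a literal may be repeated in a clause, so this covers clauses of one or two literals). -/
structure Formula where
  numVars : ℕ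
  clauses : List (Literal numVars × Literal numVars × Literal numVars)

/-- The number of clauses. -/
def Formula.numClauses (φ : Formula) : ℕ := φ.clauses.length

/-- A truth assignment satisfies a literal. -/
def Literal.Holds {n : ℕ} (τ : Fin n → Bool) (l : Literal n) : Prop := τ l.1 = l.2

/-- The formula is satisfiable. -/
def Formula.IsSat (φ : Formula) : Prop :=
  ∃ τ : Fin φ.numVars → Bool, ∀ c ∈ φ.clauses,
    Literal.Holds τ c.1 ∨ Literal.Holds τ c.2.1 ∨ Literal.Holds τ c.2.2

/-- A literal is written as its sign followed by the index of its variable in unary and a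
separator. -/
def Literal.encode {n : ℕ} (l : Literal n) : List (Option Bool) :=
  some l.2 :: List.replicate l.1 (some true) ++ [none]

/-- The encoding of a formula as a word over the alphabet `Option Bool`: the number of variables
in unary, a separator, and the literals of the successive clauses. The length of this word is
polynomial in the number of variables plus the number of clauses. -/
def Formula.encode (φ : Formula) : List (Option Bool) :=
  List.replicate φ.numVars (some true) ++ [none] ++
  φ.clauses.flatMap
    (fun c => Literal.encode c.1 ++ Literal.encode c.2.1 ++ Literal.encode c.2.2)

/-! ## Running times -/

open Classical in
/-- The decision problem `P`, whose inputs are given by the encoding `enc`, is decided by a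
deterministic Turing machine (with finitely many stacks) that halts with the correct answer on
every input `x` after at most `T x` steps. -/
def DecidableInTime {α Γ : Type} (enc : α → List Γ) (P : α → Prop) (T : α → ℝ) : Prop :=
  ∃ M : Turing.TM2ComputableAux Γ Bool, ∀ x : α, ∃ t : ℕ, (t : ℝ) ≤ T x ∧
    Nonempty (Turing.TM2OutputsInTime M.tm
      ((enc x).map M.inputAlphabet.invFun)
      (some ([decide (P x)].map M.outputAlphabet.invFun)) t)

/-- The Exponential Time Hypothesis: 3-SAT with `n` variables and `m` clauses cannot be solved in
time `2 ^ o(n + m)`. -/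
def ETH : Prop :=
  ¬ ∃ g : ℕ → ℝ, g =o[atTop] (fun s : ℕ => (s : ℝ)) ∧
    DecidableInTime Formula.encode Formula.IsSat
      (fun φ => (2 : ℝ) ^ g (φ.numVars + φ.numClauses))

/-- N-NCTD can be solved in time `2 ^ o(f(k) * |V(G)|)`, up to a factor polynomial in the length of
the input (the exponent `c = 0` means no such factor). -/
def SolvableInSubexpTime (f : ℕ → ℕ) : Prop :=
  ∃ (g : ℕ → ℝ) (c : ℕ), g =o[atTop] (fun s : ℕ => (s : ℝ)) ∧
    DecidableInTime Instance.encode Instance.IsYes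
      (fun I => (2 : ℝ) ^ g (f I.k * I.N) * (I.encode.length : ℝ) ^ c)

end NonClash

/-! Both parts rest on one reduction. For k = 1 a teaching map amounts to a choice of one element
p(C) for every concept C, and C, D do not clash iff p(C) or p(D) lies in their symmetric difference
(`nctd_le_one_iff`). The graph of a formula has six special vertices and six vertices for every
occurrence o of a literal. Its centers form a clique and its other vertices are independent, so all
concepts agree on the centers, and their traces on the other vertices can be prescribed freely
(`mem_closedNbhd`).

These traces are ∅, {z}, {w}, {z, w} for s00, s10, s01, s11; {tau_o, phi_o, del_o} together with tau
of all occurrences contradicting o for lit_o; lit_o without tau_o and phi_o for aux_o; and all phi_o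
with o in clause j for cls_j. The first four form a 4-cycle whose sides differ in a single element
each. Four sides need four teachers, so s00 is taught by z or w. This separates s00 from none of the
traces lit, aux, cls, hence each of these must be taught by an element of its own trace. As aux_o is
contained in lit_o, its teacher does not help against lit_o, so lit_o is taught by tau_o (read: the
literal is true) or by phi_o. Two contradictory occurrences cannot both use tau, since each tau lies
in both traces. The concept cls_j is taught by some phi_o, and then lit_o must use tau_o. So the
choice yields a satisfying assignment (`Teachable.rawSat`), and conversely an assignment dictates
the choice (`Teachable.of_rawSat`).

The reduction is computed by a structured stack program that writes the adjacency matrix by unary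
comparisons. `Prog.Runs.steps` compiles such programs into Turing machines at a cost of one step per
loop test. The program alone gives part (2). For part (1) it is put in front of a hypothetical fast
machine for N-NCTD (`Prog.Runs.before_outputs`). The instance has k = 1 and 6 + 18m vertices, so the
exponent g(f(1)(6 + 18m)) is o(n + m), and polynomial factors are 2 ^ o(n + m) as well; this
contradicts ETH. -/

namespace NonClash

open Turing

/-! ## A programming language for stack machines -/

/-- Stack symbols. -/
abbrev Sym : Type := Option Bool

/-- Structured programs acting on stacks indexed by `K`. -/
inductive Prog (K : Type) : Type
  | skip : Prog K
  | push (k : K) (a : Sym) : Prog K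
  /-- Pop from the stack `k` and continue depending on the symbol found. -/
  | pop (k : K) (f : Option Sym → Prog K) : Prog K
  | seq (p q : Prog K) : Prog K
  /-- Pop from the stack `k`; if a symbol satisfying `c` is found, then run the body and repeat,
  otherwise leave the loop. -/
  | loop (k : K) (c : Sym → Bool) (b : Sym → Prog K) : Prog K

namespace Prog

variable {K : Type} [DecidableEq K]

/-- Big-step semantics: `Runs p s s' t` means that `p` leads from the stacks `s` to the stacks `s'`
in `t` loop tests. -/
inductive Runs : Prog K → (K → List Sym) → (K → List Sym) → ℕ → Prop
  | skip (s) : Runs skip s s 0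
  | push (k a s) : Runs (push k a) s (Function.update s k (a :: s k)) 0
  | pop {k f s s' t} : Runs (f (s k).head?) (Function.update s k (s k).tail) s' t →
      Runs (pop k f) s s' t
  | seq {p q s s' s'' t t'} : Runs p s s' t → Runs q s' s'' t' → Runs (seq p q) s s'' (t + t')
  | loop_nil {k c b s} : s k = [] → Runs (loop k c b) s s 1
  | loop_exit {k c b s a l} : s k = a :: l → c a = false →
      Runs (loop k c b) s (Function.update s k l) 1
  | loop_cons {k c b s a l s' s'' t t'} : s k = a :: l → c a = true →
      Runs (b a) (Function.update s k l) s' t → Runs (loop k c b) s' s'' t' →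
      Runs (loop k c b) s s'' (t + t' + 1)

/-- The labels needed to compile a program: one for every loop. -/
def Lab : Prog K → Type
  | skip => Empty
  | push _ _ => Empty
  | pop _ f => Σ o, Lab (f o)
  | seq p q => Lab p ⊕ Lab q
  | loop _ _ b => Option (Σ a, Lab (b a))

noncomputable instance fintypeLab : (p : Prog K) → Fintype (Lab p)
  | skip => inferInstanceAs (Fintype Empty)
  | push _ _ => inferInstanceAs (Fintype Empty)
  | pop _ f =>
    letI := fun o => fintypeLab (f o)
    inferInstanceAs (Fintype (Σ o, Lab (f o)))
  | seq p q =>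
    letI := fintypeLab p
    letI := fintypeLab q
    inferInstanceAs (Fintype (Lab p ⊕ Lab q))
  | loop _ _ b =>
    letI := fun a => fintypeLab (b a)
    inferInstanceAs (Fintype (Option (Σ a, Lab (b a))))

end Prog

/-- An embedding of the stacks of a program into those of a stack machine. -/
structure Host (K : Type) [DecidableEq K] {K' : Type} [DecidableEq K'] (Γ' : K' → Type)
    (σ' : Type) where
  stack : K → K'
  sym : ∀ k, Γ' (stack k) ≃ Sym
  get : σ' → Option Sym
  set : Option Sym → σ'
  get_set : ∀ o, get (set o) = o
  lift : (K → List Sym) → ∀ k', List (Γ' k')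
  lift_stack : ∀ s k, lift s (stack k) = (s k).map (sym k).symm
  lift_update : ∀ s k l, lift (Function.update s k l) =
    Function.update (lift s) (stack k) (l.map (sym k).symm)

/-- `Steps M n a b`: the machine `M` leads from the configuration `a` to `b` in `n` steps. -/
def Steps {K' : Type} [DecidableEq K'] {Γ' : K' → Type} {Λ' σ' : Type}
    (M : Λ' → TM2.Stmt Γ' Λ' σ') (n : ℕ) (a b : TM2.Cfg Γ' Λ' σ') : Prop :=
  (flip Option.bind (TM2.step M))^[n] (some a) = some b

/-! ### Counting steps of stack machines -/

section Steps

variable {K' : Type} [DecidableEq K'] {Γ' : K' → Type} {Λ' σ' : Type}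
  {M : Λ' → TM2.Stmt Γ' Λ' σ'}

theorem Steps.refl (a : TM2.Cfg Γ' Λ' σ') : Steps M 0 a a := rfl

theorem Steps.trans {m n : ℕ} {a b c : TM2.Cfg Γ' Λ' σ'} (h : Steps M m a b)
    (h' : Steps M n b c) : Steps M (m + n) a c := by
  unfold Steps at *
  rw [add_comm, Function.iterate_add_apply, h, h']

theorem Steps.goto (l : Λ') (v : σ') (S : ∀ k, List (Γ' k)) :
    Steps M 1 ⟨some l, v, S⟩ (TM2.stepAux (M l) v S) := rfl

end Steps

namespace Prog

/-! ### Compiling structured programs -/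

section Compile

variable {K : Type} [DecidableEq K] {K' : Type} [DecidableEq K'] {Γ' : K' → Type}
  {σ' Λ' : Type} (H : Host K Γ' σ')

/-- Pop a symbol and branch according to it. -/
def popStmt (k : K) (f : Option Sym → TM2.Stmt Γ' Λ' σ') : TM2.Stmt Γ' Λ' σ' :=
  .pop (H.stack k) (fun _ o => H.set (o.map (H.sym k)))
    (.branch (fun v => decide (H.get v = none)) (f none)
      (.branch (fun v => decide (H.get v = some none)) (f (some none))
        (.branch (fun v => decide (H.get v = some (some true))) (f (some (some true)))
          (f (some (some false))))))

/-- The machine state holds the popped symbol only while the branches inspect it; from then on the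
symbol is remembered by the choice of the statement. The last branch is left with `some (some
false)`. -/
theorem stepAux_popStmt (k : K) (f : Option Sym → TM2.Stmt Γ' Λ' σ') (v : σ')
    (s : K → List Sym) :
    TM2.stepAux (popStmt H k f) v (H.lift s) =
      TM2.stepAux (f (s k).head?) (H.set (s k).head?)
        (H.lift (Function.update s k (s k).tail)) := by
  have h : ((H.lift s (H.stack k)).head?).map (H.sym k) = (s k).head? := by
    rw [H.lift_stack]; cases s k <;> simp
  have h' : (H.lift s (H.stack k)).tail = (s k).tail.map (H.sym k).symm := by
    rw [H.lift_stack, List.map_tail]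
  rw [popStmt, TM2.stepAux, h, h', ← H.lift_update]
  rcases (s k).head? with _ | _ | _ | _ <;> simp [H.get_set]

/-- The statement that executes a program up to its first loop test, or up to the
continuation `κ`. -/
def comp : (p : Prog K) → (Lab p → Λ') → TM2.Stmt Γ' Λ' σ' → TM2.Stmt Γ' Λ' σ'
  | skip, _, κ => κ
  | push k a, _, κ => .push (H.stack k) (fun _ => (H.sym k).symm a) κ
  | pop k f, emb, κ => popStmt H k (fun o => comp (f o) (fun l => emb ⟨o, l⟩) κ)
  | seq p q, emb, κ => comp p (fun l => emb (.inl l)) (comp q (fun l => emb (.inr l)) κ)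
  | loop _ _ _, emb, _ => .goto (fun _ => emb none)

/-- The statements at the labels of a program. -/
def code : (p : Prog K) → (Lab p → Λ') → TM2.Stmt Γ' Λ' σ' → Lab p → TM2.Stmt Γ' Λ' σ'
  | pop _ f, emb, κ, ⟨o, l⟩ => code (f o) (fun l => emb ⟨o, l⟩) κ l
  | seq p q, emb, κ, .inl l =>
    code p (fun l => emb (.inl l)) (comp H q (fun l => emb (.inr l)) κ) l
  | seq _ q, emb, κ, .inr l => code q (fun l => emb (.inr l)) κ l
  | loop k c b, emb, κ, none => popStmt H k fun o => o.elim κ fun a =>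
      bif c a then comp H (b a) (fun l => emb (some ⟨a, l⟩)) (.goto fun _ => emb none) else κ
  | loop _ _ b, emb, _, some ⟨a, l⟩ =>
    code (b a) (fun l => emb (some ⟨a, l⟩)) (.goto fun _ => emb none) l

/-- Correctness of compilation, by induction on the derivation. One machine step executes a whole
statement up to the next jump, and compiled code jumps only to loop tests; hence the exact step
count `t`. The final state `v'` is left open because continuations do not depend on it. -/
theorem Runs.steps {M : Λ' → TM2.Stmt Γ' Λ' σ'} {p : Prog K} {s s' : K → List Sym} {t : ℕ}
    (h : Runs p s s' t) : ∀ (emb : Lab p → Λ') (κ : TM2.Stmt Γ' Λ' σ'),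
    (∀ l, M (emb l) = code H p emb κ l) → ∀ v, ∃ v',
      Steps M t (TM2.stepAux (comp H p emb κ) v (H.lift s)) (TM2.stepAux κ v' (H.lift s')) := by
  induction h with
  | skip s => exact fun _ _ _ v => ⟨v, Steps.refl _⟩
  | push k a s =>
    refine fun _ κ _ v => ⟨v, ?_⟩
    simp only [comp, TM2.stepAux, H.lift_update, H.lift_stack, List.map_cons]
    exact Steps.refl _
  | @pop k f s s' t _ ih =>
    intro emb κ hM v
    simp only [comp, stepAux_popStmt]
    exact ih _ _ (fun l => hM ⟨_, l⟩) _
  | seq _ _ ih ih' =>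
    intro emb κ hM v
    obtain ⟨v', h1⟩ := ih (fun l => emb (.inl l)) (comp H _ (fun l => emb (.inr l)) κ)
      (fun l => hM (.inl l)) v
    obtain ⟨v'', h2⟩ := ih' (fun l => emb (.inr l)) κ (fun l => hM (.inr l)) v'
    exact ⟨v'', h1.trans h2⟩
  | @loop_nil k c b s hs =>
    intro emb κ hM v
    refine ⟨H.set none, ?_⟩
    have h := Steps.goto (M := M) (emb none) v (H.lift s)
    rw [hM none, code, stepAux_popStmt, hs] at h
    have e : Function.update s k ([] : List Sym).tail = s := by
      rw [List.tail_nil, ← hs, Function.update_eq_self]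
    rw [e] at h
    exact h
  | @loop_exit k c b s a l hs hc =>
    intro emb κ hM v
    refine ⟨H.set (some a), ?_⟩
    have h := Steps.goto (M := M) (emb none) v (H.lift s)
    rw [hM none, code, stepAux_popStmt, hs] at h
    simp only [Option.elim_some, List.head?_cons, hc, cond_false, List.tail_cons] at h
    exact h
  | @loop_cons k c b s a l s' s'' t t' hs hc _ _ ih ih' =>
    intro emb κ hM v
    have h := Steps.goto (M := M) (emb none) v (H.lift s)
    rw [hM none, code, stepAux_popStmt, hs] at h
    simp only [List.head?_cons, Option.elim_some, hc, cond_true, List.tail_cons] at h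
    obtain ⟨v', h1⟩ := ih (fun l => emb (some ⟨a, l⟩)) (.goto fun _ => emb none)
      (fun l => hM (some ⟨a, l⟩)) (H.set (some a))
    obtain ⟨v'', h2⟩ := ih' emb κ hM v'
    refine ⟨v'', ?_⟩
    rw [show t + t' + 1 = 1 + t + t' by ring]
    exact (h.trans h1).trans h2

end Compile

end Prog

/-! ### Initial and final configurations -/

theorem initList_stk (tm : FinTM2) (s : List (tm.Γ tm.k₀)) :
    (initList tm s).stk = Function.update (fun _ => []) tm.k₀ s := by
  funext k
  by_cases h : k = tm.k₀
  · subst h; simp [initList]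
  · simp [initList, h]

theorem haltList_stk (tm : FinTM2) (s : List (tm.Γ tm.k₁)) :
    (haltList tm s).stk = Function.update (fun _ => []) tm.k₁ s := by
  funext k
  by_cases h : k = tm.k₁
  · subst h; simp [haltList]
  · simp [haltList, h]

theorem initList_eq (tm : FinTM2) (s : List (tm.Γ tm.k₀)) :
    initList tm s = ⟨some tm.main, tm.initialState, Function.update (fun _ => []) tm.k₀ s⟩ := by
  rw [← initList_stk]; rfl

theorem haltList_eq (tm : FinTM2) (s : List (tm.Γ tm.k₁)) :
    haltList tm s = ⟨none, tm.initialState, Function.update (fun _ => []) tm.k₁ s⟩ := by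
  rw [← haltList_stk]; rfl

theorem outputs_of_steps {A B : Type} (M : TM2ComputableAux A B) {w : List A} {u : List B}
    {n T : ℕ} (hT : n ≤ T)
    (h : Steps M.tm.m n
      ⟨some M.tm.main, M.tm.initialState,
        Function.update (fun _ => []) M.tm.k₀ (w.map M.inputAlphabet.symm)⟩
      ⟨none, M.tm.initialState,
        Function.update (fun _ => []) M.tm.k₁ (u.map M.outputAlphabet.symm)⟩) :
    Nonempty (TM2OutputsInTime M.tm (w.map M.inputAlphabet.invFun)
      (some (u.map M.outputAlphabet.invFun)) T) := by
  rw [← initList_eq, ← haltList_eq] at h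
  exact ⟨⟨⟨n, h⟩, hT⟩⟩

theorem steps_of_outputs {A B : Type} {M : TM2ComputableAux A B} {w : List A} {u : List B}
    {T : ℕ} (h : Nonempty (TM2OutputsInTime M.tm (w.map M.inputAlphabet.invFun)
      (some (u.map M.outputAlphabet.invFun)) T)) :
    ∃ n ≤ T, Steps M.tm.m n
      ⟨some M.tm.main, M.tm.initialState,
        Function.update (fun _ => []) M.tm.k₀ (w.map M.inputAlphabet.symm)⟩
      ⟨none, M.tm.initialState,
        Function.update (fun _ => []) M.tm.k₁ (u.map M.outputAlphabet.symm)⟩ := by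
  obtain ⟨⟨⟨n, hn⟩, hT⟩⟩ := h
  refine ⟨n, hT, ?_⟩
  rw [← initList_eq, ← haltList_eq]
  exact hn

namespace Prog

variable {K : Type} [DecidableEq K]

/-- The stacks holding `w` on stack `k` and nothing else. -/
def single (k : K) (w : List Sym) : K → List Sym := Function.update (fun _ => []) k w

/-! ### The machine of a single program -/

section Machine

variable [Fintype K]

/-- The stacks of a program as the stacks of a machine. -/
def selfHost (K : Type) [DecidableEq K] : Host K (fun _ : K => Sym) (Option Sym) where
  stack k := k
  sym _ := Equiv.refl _
  get o := o
  set o := o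
  get_set _ := rfl
  lift s := s
  lift_stack s k := by simp
  lift_update s k l := by simp

/-- The machine running the program `p`, with input stack `i` and output stack `o`. -/
noncomputable def machine (p : Prog K) (i o : K) : TM2ComputableAux Sym Sym where
  tm :=
    { K := K
      k₀ := i
      k₁ := o
      Γ := fun _ => Sym
      Λ := Option (Lab p)
      main := none
      σ := Option Sym
      initialState := none
      -- A halting configuration is required to carry the initial state, so the register is reset
      -- before halting.
      m := fun l => l.elim (comp (selfHost K) p some (.load (fun _ => none) .halt))
        (code (selfHost K) p some (.load (fun _ => none) .halt)) }
  inputAlphabet := Equiv.refl _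
  outputAlphabet := Equiv.refl _

theorem Runs.machine_outputs {p : Prog K} {i o : K} {w w' : List Sym} {t T : ℕ}
    (h : Runs p (single i w) (single o w') t) (hT : t + 1 ≤ T) :
    Nonempty (TM2OutputsInTime (p.machine i o).tm
      (w.map (p.machine i o).inputAlphabet.invFun)
      (some (w'.map (p.machine i o).outputAlphabet.invFun)) T) := by
  refine outputs_of_steps _ hT ?_
  obtain ⟨v', h1⟩ := h.steps (M := (p.machine i o).tm.m) (selfHost K) some
    (.load (fun _ => none) .halt) (fun _ => rfl) none
  have h2 := (Steps.goto (M := (p.machine i o).tm.m) none none (single i w)).trans h1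
  have hw : w.map (p.machine i o).inputAlphabet.symm = w := List.map_id w
  have hw' : w'.map (p.machine i o).outputAlphabet.symm = w' := List.map_id w'
  rw [hw, hw', add_comm]
  exact h2

end Machine

/-! ### Running a program in front of a machine -/

section Before

variable {K₀ : Type} [DecidableEq K₀] {Δ : Type}

/-- The symbols of a machine that runs a program first. -/
abbrev sumΓ (K₀ : Type) (tm : FinTM2) : K₀ ⊕ tm.K → Type := Sum.elim (fun _ => Sym) tm.Γ

/-- The stacks of the combined machine. -/
def pairStk {tm : FinTM2} (A : K₀ → List Sym) (B : ∀ k, List (tm.Γ k)) :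
    ∀ k, List (sumΓ K₀ tm k)
  | .inl k => A k
  | .inr k => B k

theorem pairStk_update_inl {tm : FinTM2} (A : K₀ → List Sym) (B : ∀ k, List (tm.Γ k)) (k : K₀)
    (l : List Sym) :
    Function.update (pairStk A B) (.inl k) l = pairStk (Function.update A k l) B := by
  funext k'
  cases k' with
  | inl k' =>
    by_cases h : k' = k
    · subst h
      exact (Function.update_self (Sum.inl k') l (pairStk A B)).trans
        (Function.update_self k' l A).symm
    · exact (Function.update_of_ne (fun e => h (Sum.inl_injective e)) l (pairStk A B)).trans
        (Function.update_of_ne h l A).symm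
  | inr k' => exact Function.update_of_ne Sum.inr_ne_inl l (pairStk A B)

theorem pairStk_update_inr {tm : FinTM2} (A : K₀ → List Sym) (B : ∀ k, List (tm.Γ k))
    (k : tm.K) (l : List (tm.Γ k)) :
    Function.update (pairStk A B) (.inr k) l = pairStk A (Function.update B k l) := by
  funext k'
  cases k' with
  | inl k' => exact Function.update_of_ne Sum.inl_ne_inr l (pairStk A B)
  | inr k' =>
    by_cases h : k' = k
    · subst h
      exact (Function.update_self (Sum.inr k') l (pairStk A B)).trans
        (Function.update_self k' l B).symm
    · exact (Function.update_of_ne (fun e => h (Sum.inr_injective e)) l (pairStk A B)).trans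
        (Function.update_of_ne h l B).symm

/-- The stacks of a machine with `w` on its input stack. -/
def inputStk (M : TM2ComputableAux Sym Δ) (w : List Sym) : ∀ k, List (M.tm.Γ k) :=
  Function.update (fun _ => []) M.tm.k₀ (w.map M.inputAlphabet.symm)

theorem inputStk_update (M : TM2ComputableAux Sym Δ) (w l : List Sym) :
    Function.update (inputStk M w) M.tm.k₀ (l.map M.inputAlphabet.symm) = inputStk M l := by
  rw [inputStk, inputStk, Function.update_idem]

theorem update_some (s : Option K₀ → List Sym) (k : K₀) (l : List Sym) :
    Function.update (fun k => s (some k)) k l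
      = fun k' => Function.update s (some k) l (some k') := by
  funext k'
  by_cases h : k' = k
  · subst h; simp
  · simp [h]

/-- The stacks of a program, the one with index `none` being identified with the input stack of a
machine. -/
noncomputable def beforeHost (K₀ : Type) [DecidableEq K₀] {Δ : Type} (M : TM2ComputableAux Sym Δ) :
    Host (Option K₀) (sumΓ K₀ M.tm) (Option Sym ⊕ M.tm.σ) where
  stack k := k.elim (.inr M.tm.k₀) .inl
  sym k := match k with
    | none => M.inputAlphabet
    | some _ => Equiv.refl _
  get v := v.elim id fun _ => none
  set o := .inl o
  get_set _ := rfl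
  lift s := pairStk (fun k => s (some k)) (inputStk M (s none))
  lift_stack s k := by
    cases k with
    | none => exact Function.update_self M.tm.k₀ _ (fun _ => [])
    | some k => exact (List.map_id _).symm
  lift_update s k l := by
    cases k with
    | none =>
      refine Eq.trans ?_ (pairStk_update_inr (fun k => s (some k)) (inputStk M (s none)) M.tm.k₀
        (l.map M.inputAlphabet.symm)).symm
      rw [inputStk_update, Function.update_self]
      rfl
    | some k =>
      have h := pairStk_update_inl (fun k => s (some k)) (inputStk M (s none)) k l
      rw [update_some] at h
      refine h.symm.trans ?_
      congr 1
      exact (List.map_id l).symm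

section Embed

variable {tm : FinTM2} {Λ₀ : Type}

/-- The state of the second machine. -/
def pull : Option Sym ⊕ tm.σ → tm.σ := Sum.elim (fun _ => tm.initialState) id

/-- The statements of the second machine as statements of the combined machine. -/
def embStmt (K₀ Λ₀ : Type) : TM2.Stmt tm.Γ tm.Λ tm.σ →
    TM2.Stmt (sumΓ K₀ tm) (Λ₀ ⊕ tm.Λ) (Option Sym ⊕ tm.σ)
  | .push k f q => .push (.inr k) (fun v => f (pull v)) (embStmt K₀ Λ₀ q)
  | .peek k f q => .peek (.inr k) (fun v o => .inr (f (pull v) o)) (embStmt K₀ Λ₀ q)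
  | .pop k f q => .pop (.inr k) (fun v o => .inr (f (pull v) o)) (embStmt K₀ Λ₀ q)
  | .load f q => .load (fun v => .inr (f (pull v))) (embStmt K₀ Λ₀ q)
  | .branch f q q' => .branch (fun v => f (pull v)) (embStmt K₀ Λ₀ q) (embStmt K₀ Λ₀ q')
  | .goto f => .goto (fun v => .inr (f (pull v)))
  | .halt => .halt

/-- The configurations of the second machine as configurations of the combined machine. -/
def embCfg (K₀ Λ₀ : Type) (c : TM2.Cfg tm.Γ tm.Λ tm.σ) :
    TM2.Cfg (sumΓ K₀ tm) (Λ₀ ⊕ tm.Λ) (Option Sym ⊕ tm.σ) :=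
  ⟨c.l.map .inr, .inr c.var, pairStk (fun _ => []) c.stk⟩

/-- The embedded machine never touches the stacks of the program, which are empty by then, and its
states stay in the right summand, so the default value of `pull` is irrelevant. -/
theorem stepAux_embStmt (q : TM2.Stmt tm.Γ tm.Λ tm.σ) : ∀ v S,
    TM2.stepAux (embStmt K₀ Λ₀ q) (.inr v) (pairStk (fun _ => []) S) =
      embCfg K₀ Λ₀ (TM2.stepAux q v S) := by
  induction q with
  | push k f q ih =>
    intro v S
    simp only [embStmt, TM2.stepAux, ← ih, ← pairStk_update_inr]
    rfl
  | peek k f q ih =>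
    intro v S
    simp only [embStmt, TM2.stepAux, ← ih]
    rfl
  | pop k f q ih =>
    intro v S
    simp only [embStmt, TM2.stepAux, ← ih, ← pairStk_update_inr]
    rfl
  | load f q ih =>
    intro v S
    simp only [embStmt, TM2.stepAux, ← ih]
    rfl
  | branch f q q' ih ih' =>
    intro v S
    simp only [embStmt, TM2.stepAux, ih, ih', pull, Sum.elim_inr, id]
    cases f v <;> rfl
  | goto f => intro v S; rfl
  | halt => intro v S; rfl

theorem Steps.embed {M' : Λ₀ ⊕ tm.Λ → TM2.Stmt (sumΓ K₀ tm) (Λ₀ ⊕ tm.Λ) (Option Sym ⊕ tm.σ)}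
    (hM : ∀ l, M' (.inr l) = embStmt K₀ Λ₀ (tm.m l)) (n : ℕ)
    (o : Option (TM2.Cfg tm.Γ tm.Λ tm.σ)) :
    (flip Option.bind (TM2.step M'))^[n] (o.map (embCfg K₀ Λ₀)) =
      ((flip Option.bind (TM2.step tm.m))^[n] o).map (embCfg K₀ Λ₀) := by
  induction n generalizing o with
  | zero => rfl
  | succ n ih =>
    rw [Function.iterate_succ_apply, Function.iterate_succ_apply, ← ih]
    congr 1
    rcases o with _ | ⟨_ | l, v, S⟩
    · rfl
    · rfl
    · change some (TM2.stepAux (M' (.inr l)) (.inr v) (pairStk (fun _ => []) S)) = _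
      rw [hM, stepAux_embStmt]
      rfl

end Embed

/-- The machine that runs the program `p` with input stack `some i`, and then the machine `M`
whose input stack is the stack `none` of `p`. -/
noncomputable def before [Fintype K₀] (p : Prog (Option K₀)) (i : K₀) (M : TM2ComputableAux Sym Δ) :
    TM2ComputableAux Sym Δ where
  tm :=
    letI := M.tm.kFin
    letI := M.tm.ΛFin
    letI := M.tm.σFin
    { K := K₀ ⊕ M.tm.K
      k₀ := .inl i
      k₁ := .inr M.tm.k₁
      Γ := sumΓ K₀ M.tm
      Λ := Option (Lab p) ⊕ M.tm.Λ
      main := .inl none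
      σ := Option Sym ⊕ M.tm.σ
      -- The final state must equal the initial one, and `M` ends in its own initial state; hence
      -- the right summand, although the program runs first.
      initialState := .inr M.tm.initialState
      Γk₀Fin := inferInstanceAs (Fintype Sym)
      m := Sum.elim
        (fun l => l.elim
          (comp (beforeHost K₀ M) p (fun l => .inl (some l))
            (.load (fun _ => .inr M.tm.initialState) (.goto fun _ => .inr M.tm.main)))
          (code (beforeHost K₀ M) p (fun l => .inl (some l))
            (.load (fun _ => .inr M.tm.initialState) (.goto fun _ => .inr M.tm.main))))
        (fun l => embStmt K₀ _ (M.tm.m l)) }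
  inputAlphabet := Equiv.refl _
  outputAlphabet := M.outputAlphabet

/-- The output stack of `p` is the input stack of `M`, so nothing has to be copied in between. The
extra step enters `p`; resetting the state and jumping to `M` belong to the last step of `p`. -/
theorem Runs.before_outputs [Fintype K₀] {p : Prog (Option K₀)} {i : K₀}
    {M : TM2ComputableAux Sym Δ}
    {w w' : List Sym} {u : List Δ} {t T : ℕ}
    (h : Runs p (single (some i) w) (single none w') t)
    (hM : Nonempty (TM2OutputsInTime M.tm (w'.map M.inputAlphabet.invFun)
      (some (u.map M.outputAlphabet.invFun)) T)) :
    Nonempty (TM2OutputsInTime (p.before i M).tm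
      (w.map (p.before i M).inputAlphabet.invFun)
      (some (u.map (p.before i M).outputAlphabet.invFun)) (t + 1 + T)) := by
  obtain ⟨n, hT, hn⟩ := steps_of_outputs hM
  refine outputs_of_steps _ (Nat.add_le_add_left hT _) ?_
  have hn' := Steps.embed (K₀ := K₀) (M' := (p.before i M).tm.m) (fun _ => rfl) n
    (some ⟨some M.tm.main, M.tm.initialState, inputStk M w'⟩)
  unfold Steps at hn
  rw [inputStk, hn] at hn'
  obtain ⟨v', h1⟩ := h.steps (M := (p.before i M).tm.m) (beforeHost K₀ M)
    (fun l => .inl (some l))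
    (.load (fun _ => .inr M.tm.initialState) (.goto fun _ => .inr M.tm.main)) (fun _ => rfl)
    (.inr M.tm.initialState)
  have h2 := (Steps.goto (M := (p.before i M).tm.m) (.inl none) (.inr M.tm.initialState)
    ((beforeHost K₀ M).lift (single (some i) w))).trans h1
  rw [add_comm 1 t] at h2
  have hw : w.map (p.before i M).inputAlphabet.symm = w := List.map_id w
  rw [hw]
  have e : pairStk (K₀ := K₀) (tm := M.tm) (fun _ => []) (fun _ => []) = fun _ => [] := by
    funext k'
    cases k' <;> rfl
  have e₀ : (beforeHost K₀ M).lift (single (some i) w) =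
      Function.update (β := fun k => List (sumΓ K₀ M.tm k)) (fun _ => []) (Sum.inl i) w := by
    rw [← e]
    refine Eq.trans ?_ (pairStk_update_inl (tm := M.tm) (fun _ => []) (fun _ => []) i w).symm
    refine congrArg₂ pairStk ?_ ?_
    · exact (update_some (fun _ => []) i w).symm
    · exact Function.update_eq_self _ _
  have e₁ : (beforeHost K₀ M).lift (single none w') =
      pairStk (fun _ => []) (inputStk M w') := rfl
  have e₂ : pairStk (K₀ := K₀) (fun _ => [])
        (Function.update (fun _ => []) M.tm.k₁ (u.map M.outputAlphabet.symm)) =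
      Function.update (β := fun k => List (sumΓ K₀ M.tm k)) (fun _ => []) (Sum.inr M.tm.k₁)
        (u.map M.outputAlphabet.symm) := by
    rw [← e]
    exact (pairStk_update_inr (fun _ => []) (fun _ => []) M.tm.k₁ _).symm
  rw [e₀, e₁] at h2
  have h3 := h2.trans hn'
  simp only [embCfg, e₂] at h3
  exact h3

end Before

end Prog

/-! ## Non-clashing teaching maps of size one -/

section Teaching

variable {X : Type} [DecidableEq X]

/-- Guarantees that the infimum defining `nctd` is attained and is not the junk value of an empty
set. All consistent examples together separate any two distinct concepts. -/
theorem exists_isNCTM [Fintype X] (𝒞 : Finset (Finset X)) : ∃ k T, IsNCTM 𝒞 T k := by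
  refine ⟨_, fun C => Finset.univ.image fun x => (x, decide (x ∈ C)), ?_, ?_, rfl⟩
  · intro C _ e he
    obtain ⟨x, -, rfl⟩ := Finset.mem_image.1 he
    simp [Consistent]
  · intro C _ D _ h
    obtain ⟨x, hx⟩ : ∃ x, ¬ (x ∈ C ↔ x ∈ D) := by
      by_contra! h'
      exact h (Finset.ext h')
    refine ⟨(x, decide (x ∈ C)), ?_, Or.inl ?_⟩
    · exact Finset.mem_union_left _ (Finset.mem_image_of_mem _ (Finset.mem_univ x))
    · simpa [Consistent] using hx

/-- The label of an example consistent with `C` is determined by its element, so only the element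
matters. An empty set of examples may be enlarged by an arbitrary one, since further examples never
create clashes. -/
theorem nctd_le_one_iff [Fintype X] [Nonempty X] (𝒞 : Finset (Finset X)) :
    nctd 𝒞 ≤ 1 ↔ ∃ p : Finset X → X, ∀ C ∈ 𝒞, ∀ D ∈ 𝒞, C ≠ D →
      ¬ (p C ∈ C ↔ p C ∈ D) ∨ ¬ (p D ∈ C ↔ p D ∈ D) := by
  constructor
  · intro h
    obtain ⟨T, hT, hN, hk⟩ : ∃ T, IsNCTM 𝒞 T (nctd 𝒞) :=
      Nat.sInf_mem (s := {k | ∃ T, IsNCTM 𝒞 T k}) (exists_isNCTM 𝒞)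
    have hc : ∀ C ∈ 𝒞, (T C).card ≤ 1 := fun C hC =>
      (Finset.le_sup (f := fun C => (T C).card) hC).trans (hk.trans_le h)
    have hp : ∀ C, ∃ x : X, ∀ e ∈ T C, C ∈ 𝒞 → e.1 = x := by
      intro C
      by_cases h : C ∈ 𝒞 ∧ (T C).Nonempty
      · obtain ⟨hC, e, he⟩ := h
        exact ⟨e.1, fun e' he' _ => by rw [Finset.card_le_one.1 (hc C hC) e' he' e he]⟩
      · exact ⟨Classical.arbitrary X, fun e he hC => absurd ⟨hC, e, he⟩ h⟩
    choose p hp using hp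
    refine ⟨p, fun C hC D hD hCD => ?_⟩
    obtain ⟨e, he, h⟩ := hN C hC D hD hCD
    rw [Consistent, Consistent] at h
    rcases Finset.mem_union.1 he with he | he
    · left
      rw [← hp C e he hC]
      tauto
    · right
      rw [← hp D e he hD]
      tauto
  · rintro ⟨p, hp⟩
    let T : Finset X → Finset (X × Bool) := fun C => {(p C, decide (p C ∈ C))}
    have hs : 𝒞.sup (fun C => (T C).card) ≤ 1 := Finset.sup_le fun C _ => by simp [T]
    refine le_trans (Nat.sInf_le ⟨T, ?_, ?_, rfl⟩) hs
    · intro C _ e he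
      rw [Finset.mem_singleton.1 he]
      simp [Consistent]
    · intro C hC D hD h
      rcases hp C hC D hD h with h | h
      · refine ⟨(p C, decide (p C ∈ C)), by simp [T], ?_⟩
        simp only [Consistent, decide_eq_true_eq]
        tauto
      · refine ⟨(p D, decide (p D ∈ D)), by simp [T], ?_⟩
        simp only [Consistent, decide_eq_true_eq]
        tauto

end Teaching

/-! ## The graph of a formula -/

/-- The kinds of vertices: `z`, `w` and `s00`, …, `s11` occur once, the other kinds once for every
occurrence of a literal in a formula. -/
inductive Kind : Type
  | z | w | s00 | s01 | s10 | s11 | tau | phi | del | lit | aux | cls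
  deriving DecidableEq

namespace Kind

/-- The kinds of the vertices that occur once. -/
def special : List Kind := [z, w, s00, s01, s10, s11]

/-- The kinds of the vertices that belong to occurrences of literals. -/
def regular : List Kind := [tau, phi, del, lit, aux, cls]

/-- The vertices whose closed neighborhoods are the concepts. -/
def center : Kind → Bool
  | s00 | s01 | s10 | s11 | lit | aux | cls => true
  | _ => false

/-- Whether an element belongs to the concept of a center. The flags tell whether the two
occurrences stem from the same clause, from the same position, and are contradictory. -/
def mem (sc sp ct : Bool) : Kind → Kind → Bool
  | s10, z | s11, z | s01, w | s11, w => true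
  | lit, tau => (sc && sp) || ct
  | aux, tau => ct
  | lit, phi | lit, del | aux, del => sc && sp
  | cls, phi => sc
  | _, _ => false

/-- Adjacency of vertices. -/
def adj (sc sp ct : Bool) (p q : Kind) : Bool :=
  if p.center && q.center then !(decide (p = q) && sc && sp)
    else mem sc sp ct p q || mem sc sp ct q p

theorem adj_symm (sc sp ct : Bool) (p q : Kind) : adj sc sp ct p q = adj sc sp ct q p := by
  cases p <;> cases q <;> cases sc <;> cases sp <;> cases ct <;> rfl

theorem adj_irrefl (p : Kind) : adj true true false p p = false := by
  cases p <;> rfl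

/-- Between special and regular vertices only pairs of centers are adjacent, and these always are.
Therefore the dummy index, position and literal of a special vertex do no harm, and the program can
write such bits without any comparison. -/
theorem adj_special (sc sp ct : Bool) {p q : Kind}
    (h : p ∈ special ∧ q ∈ regular ∨ p ∈ regular ∧ q ∈ special) :
    adj sc sp ct p q = adj true true false p q := by
  revert h
  cases p <;> cases q <;> simp [adj, mem, center, special, regular]

end Kind

/-- Literals without a bound on the variables. -/
abbrev RawLiteral : Type := ℕ × Bool

/-- Clauses without a bound on the variables. -/
abbrev RawClause : Type := RawLiteral × RawLiteral × RawLiteral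

/-- The literals of a clause with their positions. -/
def RawClause.occs (c : RawClause) : List (ℕ × RawLiteral) := [(0, c.1), (1, c.2.1), (2, c.2.2)]

/-- Satisfiability of a list of clauses. -/
def RawSat (cl : List RawClause) : Prop :=
  ∃ τ : ℕ → Bool, ∀ c ∈ cl, ∃ o ∈ RawClause.occs c, τ o.2.1 = o.2.2

/-- Forget the bound on the variables. -/
def Literal.raw {n : ℕ} (l : Literal n) : RawLiteral := (l.1, l.2)

/-- The clauses of a formula without the bound on the variables. -/
def Formula.raw (φ : Formula) : List RawClause :=
  φ.clauses.map fun c => (c.1.raw, c.2.1.raw, c.2.2.raw)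

theorem Formula.isSat_iff (φ : Formula) : φ.IsSat ↔ RawSat φ.raw := by
  constructor
  · rintro ⟨τ, h⟩
    refine ⟨fun i => if h : i < φ.numVars then τ ⟨i, h⟩ else true, fun c hc => ?_⟩
    obtain ⟨c', hc', rfl⟩ := List.mem_map.1 hc
    simpa [RawClause.occs, Literal.raw, Literal.Holds] using h c' hc'
  · rintro ⟨τ, h⟩
    refine ⟨fun i => τ i, fun c hc => ?_⟩
    simpa [RawClause.occs, Literal.raw, Literal.Holds] using h _ (List.mem_map_of_mem hc)

/-- Descriptions of vertices: the kind, the index of the clause, the position in the clause, and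
the literal. -/
structure Rec where
  kind : Kind
  idx : ℕ
  pos : ℕ
  lit : RawLiteral

/-- Two literals are contradictory. -/
def contra (l l' : RawLiteral) : Bool := l.1 == l'.1 && l.2 != l'.2

theorem contra_comm (l l' : RawLiteral) : contra l l' = contra l' l := by
  rw [Bool.eq_iff_iff]
  simp only [contra, Bool.and_eq_true, beq_iff_eq, bne_iff_ne]
  tauto

/-- Adjacency of vertices in terms of their descriptions. -/
def Rec.bit (r r' : Rec) : Bool :=
  Kind.adj (r.idx == r'.idx) (r.pos == r'.pos) (contra r.lit r'.lit) r.kind r'.kind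

/-- The concepts in terms of the descriptions of vertices. -/
def Rec.mem (r r' : Rec) : Bool :=
  r'.kind.center || Kind.mem (r.idx == r'.idx) (r.pos == r'.pos) (contra r.lit r'.lit)
    r.kind r'.kind

theorem Rec.bit_symm (r r' : Rec) : r.bit r' = r'.bit r := by
  rw [bit, bit, Kind.adj_symm, contra_comm, Bool.beq_comm (a := r.idx), Bool.beq_comm (a := r.pos)]

theorem Rec.bit_irrefl (r : Rec) : r.bit r = false := by
  have h : contra r.lit r.lit = false := by simp [contra]
  rw [bit, h, beq_self_eq_true, beq_self_eq_true, Kind.adj_irrefl]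

/-- The description of a special vertex. -/
def Rec.spec (p : Kind) : Rec := ⟨p, 0, 0, (0, true)⟩

/-- The vertices that belong to the clause with index `j`. -/
def block (j : ℕ) (c : RawClause) : List Rec :=
  c.occs.flatMap fun o => Kind.regular.map fun q => ⟨q, j, o.1, o.2⟩

/-- The vertices. -/
def records (cl : List RawClause) : List Rec :=
  Kind.special.map Rec.spec ++ cl.zipIdx.flatMap fun x => block x.2 x.1

/-- The literal `l` occurs at the position `a` of the clause with index `j`. -/
def Occ (cl : List RawClause) (j a : ℕ) (l : RawLiteral) : Prop :=
  ∃ c, cl[j]? = some c ∧ (a, l) ∈ c.occs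

theorem Occ.unique {cl : List RawClause} {j a : ℕ} {l l' : RawLiteral} (h : Occ cl j a l)
    (h' : Occ cl j a l') : l = l' := by
  obtain ⟨c, hc, h⟩ := h
  obtain ⟨c', hc', h'⟩ := h'
  obtain rfl : c = c' := by rw [hc] at hc'; exact Option.some.inj hc'
  simp only [RawClause.occs, List.mem_cons, Prod.mk.injEq, List.not_mem_nil, or_false] at h h'
  rcases h with ⟨rfl, rfl⟩ | ⟨rfl, rfl⟩ | ⟨rfl, rfl⟩ <;> simp at h' <;> exact h'.symm

theorem mem_records {cl : List RawClause} {r : Rec} : r ∈ records cl ↔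
    (∃ p ∈ Kind.special, r = Rec.spec p) ∨
      r.kind ∈ Kind.regular ∧ Occ cl r.idx r.pos r.lit := by
  simp only [records, List.mem_append, List.mem_map, List.mem_flatMap, block, Occ]
  constructor
  · rintro (⟨p, hp, rfl⟩ | ⟨⟨c, j⟩, hc, ⟨a, l⟩, hl, q, hq, rfl⟩)
    · exact Or.inl ⟨p, hp, rfl⟩
    · exact Or.inr ⟨hq, c, List.mem_zipIdx_iff_getElem?.1 hc, hl⟩
  · rintro (⟨p, hp, rfl⟩ | ⟨hq, c, hc, hl⟩)
    · exact Or.inl ⟨p, hp, rfl⟩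
    · exact Or.inr ⟨(c, r.idx), List.mem_zipIdx_iff_getElem?.2 hc, (r.pos, r.lit), hl, r.kind, hq,
        rfl⟩

/-- The literal is determined by clause and position, and special and regular kinds are disjoint. So
the flags compared by `Kind.adj` detect equality of vertices. -/
theorem records_ext {cl : List RawClause} {r r' : Rec} (h : r ∈ records cl) (h' : r' ∈ records cl)
    (hk : r.kind = r'.kind) (hi : r.idx = r'.idx) (hp : r.pos = r'.pos) : r = r' := by
  have hd : ∀ p ∈ Kind.special, p ∉ Kind.regular := by
    intro p; cases p <;> decide
  rcases mem_records.1 h with ⟨p, hs, rfl⟩ | ⟨hq, ho⟩ <;>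
    rcases mem_records.1 h' with ⟨p', hs', rfl⟩ | ⟨hq', ho'⟩
  · simp only [Rec.spec] at hk; rw [hk]
  · rw [← hk] at hq'; exact absurd hq' (hd _ hs)
  · rw [hk] at hq; exact absurd hq (hd _ hs')
  · obtain ⟨k, j, a, l⟩ := r
    obtain ⟨k', j', a', l'⟩ := r'
    obtain rfl : k = k' := hk
    obtain rfl : j = j' := hi
    obtain rfl : a = a' := hp
    obtain rfl : l = l' := ho.unique ho'
    rfl

theorem records_nodup (cl : List RawClause) : (records cl).Nodup := by
  have hd : ∀ p ∈ Kind.special, p ∉ Kind.regular := by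
    intro p; cases p <;> decide
  refine List.Nodup.append ?_ ?_ ?_
  · refine List.Nodup.map (fun p q h => congrArg Rec.kind h) (by decide)
  · rw [List.nodup_flatMap]
    constructor
    · intro x _
      rw [block, List.nodup_flatMap]
      constructor
      · intro o _
        exact List.Nodup.map (fun p q h => congrArg Rec.kind h) (by decide)
      · simp [RawClause.occs, Function.onFun, List.disjoint_left]
    · have h : (cl.zipIdx.map Prod.snd).Nodup := by
        rw [List.zipIdx_map_snd]
        exact List.nodup_range'
      refine (List.pairwise_map.1 h).imp ?_
      intro x y hxy
      simp only [Function.onFun, List.disjoint_left, block, List.mem_flatMap, List.mem_map]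
      rintro r ⟨_, _, _, _, rfl⟩ ⟨_, _, _, _, h⟩
      exact hxy (congrArg Rec.idx h).symm
  · rw [List.disjoint_left]
    intro r h h'
    obtain ⟨p, hp, rfl⟩ := List.mem_map.1 h
    obtain ⟨x, _, h'⟩ := List.mem_flatMap.1 h'
    obtain ⟨o, _, h'⟩ := List.mem_flatMap.1 h'
    obtain ⟨q, hq, h'⟩ := List.mem_map.1 h'
    have := congrArg Rec.kind h'
    simp only [Rec.spec] at this
    exact hd p hp (this ▸ hq)

theorem length_records (cl : List RawClause) : (records cl).length = 6 + 18 * cl.length := by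
  have h : ∀ (l : List RawClause) (k : ℕ),
      ((l.zipIdx k).flatMap fun x => block x.2 x.1).length = 18 * l.length := by
    intro l
    induction l with
    | nil => simp
    | cons c l ih =>
      intro k
      rw [List.zipIdx_cons, List.flatMap_cons, List.length_append, ih, List.length_cons]
      simp [block, RawClause.occs, Kind.regular]
      ring
  rw [records, List.length_append, h]
  rfl

/-- A way of teaching every center by one element, in terms of descriptions of vertices. -/
def Teachable (cl : List RawClause) : Prop :=
  ∃ π : Rec → Rec, (∀ u ∈ records cl, π u ∈ records cl) ∧
    ∀ u ∈ records cl, ∀ v ∈ records cl, u.kind.center = true → v.kind.center = true →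
      (∃ x ∈ records cl, u.mem x ≠ v.mem x) →
      u.mem (π u) ≠ v.mem (π u) ∨ u.mem (π v) ≠ v.mem (π v)

/-- A true literal is taught by its `tau`, a false one by its `phi`, `aux` by `del`, and a clause by
the `phi` of a true literal in it. Then `phi` of a false literal lies in no other `lit`, and `tau`
of a true one only in those of contradictory, hence false, occurrences. Around the 4-cycle `s00`,
`s11` use `z` and `s01`, `s10` use `w`, one teacher for each side. -/
theorem Teachable.of_rawSat {cl : List RawClause} (h : RawSat cl) : Teachable cl := by
  obtain ⟨τ, hτ⟩ := h
  have hch : ∀ j : ℕ, ∃ o : ℕ × RawLiteral, ∀ c : RawClause,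
      cl[j]? = some c → o ∈ c.occs ∧ τ o.2.1 = o.2.2 := by
    intro j
    rcases hc : cl[j]? with _ | c
    · exact ⟨(0, 0, true), fun c h => nomatch h⟩
    · obtain ⟨o, ho⟩ := hτ c (List.mem_of_getElem? hc)
      exact ⟨o, fun c' h => Option.some.inj h ▸ ho⟩
  choose ch hch using hch
  let π : Rec → Rec := fun u => match u.kind with
    | .s01 | .s10 => Rec.spec .w
    | .lit => if τ u.lit.1 = u.lit.2 then ⟨.tau, u.idx, u.pos, u.lit⟩ else
        ⟨.phi, u.idx, u.pos, u.lit⟩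
    | .aux => ⟨.del, u.idx, u.pos, u.lit⟩
    | .cls => ⟨.phi, u.idx, (ch u.idx).1, (ch u.idx).2⟩
    | _ => Rec.spec .z
  have hz : Rec.spec .z ∈ records cl := mem_records.2 (.inl ⟨.z, by decide, rfl⟩)
  have hw : Rec.spec .w ∈ records cl := mem_records.2 (.inl ⟨.w, by decide, rfl⟩)
  -- Regular centers are taught by elements of their own that no special center contains, which
  -- settles all mixed pairs.
  have hspec : ∀ p ∈ Kind.special, p.center = true → ∀ v ∈ records cl, v.kind ∈ Kind.regular →
      v.kind.center = true → v.mem (π v) = true ∧ (Rec.spec p).mem (π v) = false := by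
    rintro p hp hpc ⟨k, j, a, l⟩ hv hk hkc
    cases k <;> simp [Kind.regular, Kind.center] at hk hkc <;>
      cases p <;> simp [Kind.special, Kind.center] at hp hpc <;>
      simp only [π] <;>
      (try split_ifs) <;> simp [Rec.mem, Rec.spec, Kind.center, Kind.mem]
  refine ⟨π, fun u hu => ?_, fun u hu v hv hcu hcv hx => ?_⟩
  · rcases mem_records.1 hu with ⟨p, hp, rfl⟩ | ⟨hk, ho⟩
    · cases p <;> simp [Kind.special] at hp <;> first | exact hz | exact hw
    · obtain ⟨k, j, a, l⟩ := u
      have hl : ∀ k ∈ Kind.regular, (⟨k, j, a, l⟩ : Rec) ∈ records cl :=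
        fun k hk => mem_records.2 (.inr ⟨hk, ho⟩)
      cases k <;> simp [Kind.regular] at hk
      · exact hz
      · exact hz
      · exact hz
      · simp only [π]
        split_ifs
        · exact hl _ (by decide)
        · exact hl _ (by decide)
      · exact hl _ (by decide)
      · obtain ⟨c, hc, -⟩ := ho
        exact mem_records.2 (.inr ⟨show Kind.phi ∈ Kind.regular by decide, c, hc, (hch j c hc).1⟩)
  · rcases mem_records.1 hu with ⟨p, hp, rfl⟩ | ⟨hk, ho⟩ <;>
      rcases mem_records.1 hv with ⟨p', hp', rfl⟩ | ⟨hk', ho'⟩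
    · obtain ⟨x, -, hx⟩ := hx
      cases p <;> simp [Kind.special, Kind.center, Rec.spec] at hp hcu <;>
        cases p' <;> simp [Kind.special, Kind.center, Rec.spec] at hp' hcv <;>
        first
        | exact absurd rfl hx
        | simp [Rec.mem, Rec.spec, Kind.center, Kind.mem, π]
    · obtain ⟨h1, h2⟩ := hspec p hp hcu v hv hk' hcv
      right; rw [h1, h2]; decide
    · obtain ⟨h1, h2⟩ := hspec p' hp' hcv u hu hk hcu
      left; rw [h1, h2]; decide
    · obtain ⟨k, j, a, l⟩ := u
      obtain ⟨k', j', a', l'⟩ := v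
      have hne : ¬ (k = k' ∧ j = j' ∧ a = a') := by
        rintro ⟨rfl, rfl, rfl⟩
        obtain ⟨x, -, hx⟩ := hx
        exact hx (by rw [records_ext hu hv rfl rfl rfl])
      -- The three `cls` vertices of a clause have the same concept, so such a pair needs no
      -- separation.
      have hcls : ¬ (k = .cls ∧ k' = .cls ∧ j = j') := by
        rintro ⟨rfl, rfl, rfl⟩
        obtain ⟨⟨q, i, b, m⟩, -, hx⟩ := hx
        apply hx
        cases q <;> simp [Rec.mem, Kind.center, Kind.mem]
      have hct : τ l.1 = l.2 → τ l'.1 = l'.2 → contra l l' = false := by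
        intro h h'
        by_contra hc
        simp only [contra, Bool.and_eq_true, beq_iff_eq, bne_iff_ne, Bool.not_eq_false] at hc
        exact hc.2 (by rw [← h, ← h', hc.1])
      have hct' : contra l' l = contra l l' := contra_comm _ _
      -- Needed for `cls` against `lit`: the only literal of the clause containing the chosen `phi`
      -- is true, hence taught by its `tau`, which is not in `cls`.
      have hlc : ∀ {j a l} {j'}, Occ cl j a l → j = j' → a = (ch j').1 → τ l.1 = l.2 := by
        rintro j a l j' ho rfl rfl
        obtain ⟨c, hc, -⟩ := id ho
        obtain ⟨h1, h2⟩ := hch j c hc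
        rw [ho.unique ⟨c, hc, h1⟩]
        exact h2
      have hlc1 := hlc (j' := j') ho
      have hlc2 := hlc (j' := j) ho'
      simp only at hlc1 hlc2
      have hsame : j = j' → a = a' → contra l l' = false := by
        rintro rfl rfl
        rw [show l = l' from ho.unique ho']
        simp [contra]
      clear hx hspec hz hw hu hv ho ho' hch hτ hlc
      cases k <;> simp [Kind.regular, Kind.center] at hk hcu <;>
        cases k' <;> simp [Kind.regular, Kind.center] at hk' hcv <;>
        clear hk hcu hk' hcv <;> simp only [π] <;> by_cases t : τ l.1 = l.2 <;>
        by_cases t' : τ l'.1 = l'.2 <;> simp [t, t'] at hct hlc1 hlc2 <;>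
        simp [Rec.mem, Kind.center, Kind.mem, t, t', hct', hct] at hne hcls ⊢ <;> grind

/-- The 4-cycle of special centers forces all regular centers to be taught positively; under this
constraint `tau` as teacher of `lit` encodes truth. -/
theorem Teachable.rawSat {cl : List RawClause} (h : Teachable cl) : RawSat cl := by
  obtain ⟨π, hπ, h⟩ := h
  have hs : ∀ p ∈ Kind.special, Rec.spec p ∈ records cl :=
    fun p hp => mem_records.2 (.inl ⟨p, hp, rfl⟩)
  have hne : ∀ p ∈ Kind.special, ∀ x ∈ records cl, x.kind = p → x = Rec.spec p := by
    intro p hp x hx hk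
    rcases mem_records.1 hx with ⟨q, hq, rfl⟩ | ⟨hq, -⟩
    · rw [← hk]; rfl
    · rw [hk] at hq
      cases p <;> simp [Kind.special, Kind.regular] at hp hq
  have hz : ∀ {p q x}, (Rec.spec p).mem x ≠ (Rec.spec q).mem x →
      (p, q) ∈ [(Kind.s00, Kind.s10), (.s01, .s11)] → x.kind = .z := by
    rintro p q ⟨k, i, b, m⟩ hx hpq
    simp only [List.mem_cons, Prod.mk.injEq, List.not_mem_nil, or_false] at hpq
    rcases hpq with ⟨rfl, rfl⟩ | ⟨rfl, rfl⟩ <;> cases k <;>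
      simp [Rec.mem, Kind.center, Kind.mem, Rec.spec] at hx ⊢
  have hw : ∀ {p q x}, (Rec.spec p).mem x ≠ (Rec.spec q).mem x →
      (p, q) ∈ [(Kind.s00, Kind.s01), (.s10, .s11)] → x.kind = .w := by
    rintro p q ⟨k, i, b, m⟩ hx hpq
    simp only [List.mem_cons, Prod.mk.injEq, List.not_mem_nil, or_false] at hpq
    rcases hpq with ⟨rfl, rfl⟩ | ⟨rfl, rfl⟩ <;> cases k <;>
      simp [Rec.mem, Kind.center, Kind.mem, Rec.spec] at hx ⊢
  -- Pigeonhole: each side of the 4-cycle needs an endpoint taught by the one element in which its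
  -- ends differ, and a vertex serves at most one of its two sides. Four sides thus use all four
  -- vertices, in particular `s00`.
  have h00 : (π (Rec.spec .s00)).kind = .z ∨ (π (Rec.spec .s00)).kind = .w := by
    have e1 := (h _ (hs .s00 (by decide)) _ (hs .s10 (by decide)) rfl rfl
      ⟨_, hs .z (by decide), by decide⟩).imp (fun e => hz e (by decide)) (fun e => hz e (by decide))
    have e2 := (h _ (hs .s01 (by decide)) _ (hs .s11 (by decide)) rfl rfl
      ⟨_, hs .z (by decide), by decide⟩).imp (fun e => hz e (by decide)) (fun e => hz e (by decide))
    have e3 := (h _ (hs .s00 (by decide)) _ (hs .s01 (by decide)) rfl rfl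
      ⟨_, hs .w (by decide), by decide⟩).imp (fun e => hw e (by decide)) (fun e => hw e (by decide))
    have e4 := (h _ (hs .s10 (by decide)) _ (hs .s11 (by decide)) rfl rfl
      ⟨_, hs .w (by decide), by decide⟩).imp (fun e => hw e (by decide)) (fun e => hw e (by decide))
    grind
  -- every regular center is taught by one of its own elements
  have hpos : ∀ v ∈ records cl, v.kind ∈ Kind.regular → v.kind.center = true →
      (∃ x ∈ records cl, x.kind.center = false ∧ v.mem x = true) →
      v.mem (π v) = true ∧ (π v).kind.center = false := by
    rintro v hv hk hc ⟨x, hx, hxc, hvx⟩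
    have e0 : ∀ y : Rec, (Rec.spec .s00).mem y = y.kind.center := by
      rintro ⟨k, i, b, m⟩
      cases k <;> rfl
    have e1 : ∀ y : Rec, y.kind = .z ∨ y.kind = .w → v.mem y = false := by
      rintro ⟨k, i, b, m⟩ hy
      obtain ⟨k', i', b', m'⟩ := v
      rcases hy with rfl | rfl <;> cases k' <;> simp [Kind.regular] at hk <;> rfl
    have e2 : ∀ y : Rec, y.kind.center = true → v.mem y = true := by
      intro y hy
      rw [Rec.mem, hy, Bool.true_or]
    rcases h _ (hs .s00 (by decide)) v hv rfl hc
      ⟨x, hx, by rw [hvx, e0, hxc]; decide⟩ with e | e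
    · refine absurd ?_ e
      rw [e1 _ h00, e0]
      rcases h00 with e | e <;> rw [e] <;> rfl
    · rw [e0] at e
      by_cases hy : (π v).kind.center = true
      · rw [hy, e2 _ hy] at e
        exact absurd rfl e
      · rw [Bool.not_eq_true] at hy
        rw [hy] at e
        exact ⟨by simpa using e.symm, hy⟩
  have hr : ∀ {j a l}, Occ cl j a l → ∀ k ∈ Kind.regular, (⟨k, j, a, l⟩ : Rec) ∈ records cl :=
    fun ho k hk => mem_records.2 (.inr ⟨hk, ho⟩)
  have haux : ∀ {j a l}, Occ cl j a l → (Rec.mk .aux j a l).mem (π ⟨.aux, j, a, l⟩) = true ∧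
      (π ⟨.aux, j, a, l⟩).kind.center = false := fun ho =>
    hpos _ (hr ho .aux (by decide)) (by simp [Kind.regular]) rfl
      ⟨_, hr ho .del (by decide), rfl, by simp [Rec.mem, Kind.mem]⟩
  -- the center `lit` is taught by its element `tau` or `phi`
  have hlit : ∀ {j a l}, Occ cl j a l → π ⟨.lit, j, a, l⟩ = ⟨.tau, j, a, l⟩ ∨
      π ⟨.lit, j, a, l⟩ = ⟨.phi, j, a, l⟩ := by
    intro j a l ho
    have hl := hr ho .lit (by decide)
    obtain ⟨h1, h2⟩ := haux ho
    obtain ⟨h3, h4⟩ := hpos _ hl (by simp [Kind.regular]) rfl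
      ⟨_, hr ho .del (by decide), rfl, by simp [Rec.mem, Kind.mem]⟩
    have h5 := h _ (hr ho .aux (by decide)) _ hl rfl rfl
      ⟨_, hr ho .phi (by decide), by simp [Rec.mem, Kind.mem, Kind.center]⟩
    have h6 := hπ _ hl
    generalize π ⟨.aux, j, a, l⟩ = x at *
    generalize π ⟨.lit, j, a, l⟩ = y at *
    -- The concept of `aux` is contained in that of `lit`, so the positive teacher of `aux` cannot
    -- separate the two and that of `lit` has to lie outside `aux`.
    have h7 : (Rec.mk .lit j a l).mem x = true := by
      obtain ⟨k, i, b, m⟩ := x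
      clear h h3 h4 h5 h6
      cases k <;> simp [Rec.mem, Kind.mem, Kind.center] at h1 h2 ⊢
      · exact Or.inr h1
      · exact h1
    have h8 : (Rec.mk .aux j a l).mem y = false := by
      rw [h1, h7, h3] at h5
      simpa using h5
    obtain ⟨k, i, b, m⟩ := y
    have h9 : (k = .tau ∨ k = .phi) ∧ j = i ∧ a = b := by
      clear h h5 h6
      cases k <;> simp [Rec.mem, Kind.mem, Kind.center] at h3 h4 h8 ⊢
      · grind
      · exact h3
      · grind
    obtain ⟨hk, rfl, rfl⟩ := h9
    rcases hk with rfl | rfl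
    · exact Or.inl (records_ext h6 (hr ho _ (by decide)) rfl rfl rfl)
    · exact Or.inr (records_ext h6 (hr ho _ (by decide)) rfl rfl rfl)
  have hcls : ∀ {j a l}, Occ cl j a l → ∃ a' l', Occ cl j a' l' ∧
      π ⟨.cls, j, a, l⟩ = ⟨.phi, j, a', l'⟩ := by
    intro j a l ho
    have hl := hr ho .cls (by decide)
    obtain ⟨h3, h4⟩ := hpos _ hl (by simp [Kind.regular]) rfl
      ⟨_, hr ho .phi (by decide), rfl, by simp [Rec.mem, Kind.mem]⟩
    have h6 := hπ _ hl
    generalize π ⟨.cls, j, a, l⟩ = y at *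
    obtain ⟨k, i, b, m⟩ := y
    have h9 : k = .phi ∧ j = i := by
      clear h h6
      cases k <;> simp [Rec.mem, Kind.mem, Kind.center] at h3 h4 ⊢
      exact h3
    obtain ⟨rfl, rfl⟩ := h9
    rcases mem_records.1 h6 with ⟨p, hp, e⟩ | ⟨-, ho'⟩
    · have := congrArg Rec.kind e
      simp only [Rec.spec] at this
      rw [← this] at hp
      exact absurd hp (by decide)
    · exact ⟨b, m, ho', rfl⟩
  -- The `tau` of either of two contradictory occurrences belongs to both `lit` concepts, so it
  -- cannot serve as teacher for both of them.
  have htau : ∀ {j a l j' a' l'}, Occ cl j a l → Occ cl j' a' l' → contra l l' = true →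
      ¬ (π ⟨.lit, j, a, l⟩ = ⟨.tau, j, a, l⟩ ∧ π ⟨.lit, j', a', l'⟩ = ⟨.tau, j', a', l'⟩) := by
    rintro j a l j' a' l' ho ho' hc ⟨e, e'⟩
    have hn : ¬ (j = j' ∧ a = a') := by
      rintro ⟨rfl, rfl⟩
      rw [ho.unique ho'] at hc
      simp [contra] at hc
    have hc' := contra_comm l l' ▸ hc
    have h5 := h _ (hr ho .lit (by decide)) _ (hr ho' .lit (by decide)) rfl rfl
      ⟨_, hr ho .phi (by decide), by simp [Rec.mem, Kind.mem, Kind.center]; grind⟩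
    rw [e, e'] at h5
    simp [Rec.mem, Kind.mem, Kind.center, hc, hc'] at h5
  -- That `phi` lies in both `cls` and `lit`; if `lit` were taught by it as well, the two would
  -- clash.
  have hphi : ∀ {j a l a' l'}, Occ cl j a l → Occ cl j a' l' →
      π ⟨.cls, j, a, l⟩ = ⟨.phi, j, a', l'⟩ → π ⟨.lit, j, a', l'⟩ = ⟨.tau, j, a', l'⟩ := by
    intro j a l a' l' ho ho' e
    refine (hlit ho').resolve_right fun e' => ?_
    have h5 := h _ (hr ho .cls (by decide)) _ (hr ho' .lit (by decide)) rfl rfl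
      ⟨_, hr ho' .tau (by decide), by simp [Rec.mem, Kind.mem, Kind.center]⟩
    rw [e, e'] at h5
    simp [Rec.mem, Kind.mem, Kind.center] at h5
  classical
  -- A variable is true iff some positive occurrence of it is taught by `tau`. A negative occurrence
  -- taught by `tau` excludes this by `htau`.
  refine ⟨fun i => decide (∃ j a, Occ cl j a (i, true) ∧
    π ⟨.lit, j, a, (i, true)⟩ = ⟨.tau, j, a, (i, true)⟩), fun c hc => ?_⟩
  obtain ⟨j, hj⟩ := List.getElem?_of_mem hc
  have ho : Occ cl j 0 c.1 := ⟨c, hj, by simp [RawClause.occs]⟩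
  obtain ⟨a, l, ho', e⟩ := hcls ho
  have e' := hphi ho ho' e
  obtain ⟨c', hc', hl⟩ := id ho'
  obtain rfl : c = c' := by rw [hj] at hc'; exact Option.some.inj hc'
  refine ⟨(a, l), hl, ?_⟩
  obtain ⟨i, s⟩ := l
  cases s with
  | true => exact decide_eq_true ⟨j, a, ho', e'⟩
  | false =>
    refine decide_eq_false ?_
    rintro ⟨j', a', ho'', e''⟩
    exact htau ho'' ho' (by simp [contra]) ⟨e'', e'⟩

/-- The graph of a list of clauses. -/
def clauseGraph (cl : List RawClause) : SimpleGraph (Fin (records cl).length) where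
  Adj i j := (records cl)[i].bit (records cl)[j] = true
  symm := ⟨fun i j h => by rw [Rec.bit_symm]; exact h⟩
  loopless := ⟨fun i h => by rw [Rec.bit_irrefl] at h; exact Bool.false_ne_true h⟩

/-- For a center the clique supplies all other centers, and closedness supplies the vertex itself.
At a non-center only one of the two `Kind.mem` terms of the adjacency survives, as `Kind.mem`
vanishes when its first argument is not a center. -/
theorem mem_closedNbhd {cl : List RawClause} {u x : Fin (records cl).length}
    (hu : (records cl)[u].kind.center = true) :
    x ∈ closedNbhd (clauseGraph cl) u ↔ (records cl)[u].mem (records cl)[x] = true := by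
  have e : x ∈ closedNbhd (clauseGraph cl) u ↔
      x = u ∨ (records cl)[u].bit (records cl)[x] = true := by
    simp only [closedNbhd, Finset.mem_filter, Finset.mem_univ, true_and]
    rfl
  rw [e]
  rcases em (x = u) with rfl | hx
  · simp only [true_or, Rec.mem, hu, Bool.true_or]
  · simp only [hx, false_or]
    have hk : ¬ ((records cl)[u].kind = (records cl)[x].kind ∧
        (records cl)[u].idx = (records cl)[x].idx ∧ (records cl)[u].pos = (records cl)[x].pos) := by
      rintro ⟨h1, h2, h3⟩
      have := records_ext (List.getElem_mem u.2) (List.getElem_mem x.2) h1 h2 h3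
      exact hx (Fin.ext ((List.Nodup.getElem_inj_iff (records_nodup cl)).1 this)).symm
    generalize (records cl)[u] = r at *
    generalize (records cl)[x] = r' at *
    clear hx
    obtain ⟨k, j, a, l⟩ := r
    obtain ⟨k', j', a', l'⟩ := r'
    simp only [Rec.bit, Rec.mem, Kind.adj] at *
    by_cases hc : k'.center = true
    · simp only [hu, hc, Bool.and_self, if_true, Bool.true_or, iff_true]
      simp only [Bool.not_eq_true', Bool.and_eq_false_iff,
        decide_eq_false_iff_not, beq_eq_false_iff_ne]
      tauto
    · simp only [hc, Bool.and_false, Bool.false_eq_true, if_false, Bool.false_or]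
      have : ∀ sc sp ct, Kind.mem sc sp ct k' k = false := by
        intro sc sp ct
        cases k' <;> simp [Kind.center] at hc <;> simp [Kind.mem]
      rw [this, Bool.or_false]

/-- The centers of the graph of a list of clauses. -/
def clauseCenters (cl : List RawClause) : Finset (Fin (records cl).length) :=
  Finset.univ.filter fun i => (records cl)[i].kind.center = true

/-- Translates between teachers of concepts and teachers of centers. Different centers may share a
concept, so one center per concept is chosen in the backward direction; `Teachable` demands nothing
of centers with equal concepts. -/
theorem nctd_clauseGraph_le_one_iff (cl : List RawClause) :
    nctd ((clauseCenters cl).image (closedNbhd (clauseGraph cl))) ≤ 1 ↔ Teachable cl := by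
  have hpos : 0 < (records cl).length := by rw [length_records]; omega
  have : Nonempty (Fin (records cl).length) := ⟨⟨0, hpos⟩⟩
  have hidx : ∀ r : Rec, ∃ i : Fin (records cl).length, r ∈ records cl → (records cl)[i] = r := by
    intro r
    by_cases h : r ∈ records cl
    · obtain ⟨i, hi, h⟩ := List.getElem_of_mem h
      exact ⟨⟨i, hi⟩, fun _ => h⟩
    · exact ⟨⟨0, hpos⟩, fun h' => absurd h' h⟩
  choose idx hidx using hidx
  have hc : ∀ i : Fin (records cl).length, i ∈ clauseCenters cl ↔
      (records cl)[i].kind.center = true := by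
    intro i
    exact (Finset.mem_filter.trans (and_iff_right (Finset.mem_univ _)))
  have hmem : ∀ i x : Fin (records cl).length, (records cl)[i].kind.center = true →
      (x ∈ closedNbhd (clauseGraph cl) i ↔ (records cl)[i].mem (records cl)[x] = true) :=
      fun i x h => mem_closedNbhd h
  rw [nctd_le_one_iff]
  constructor
  · rintro ⟨p, hp⟩
    refine ⟨fun r => (records cl)[p (closedNbhd (clauseGraph cl) (idx r))]'(p _).2,
      fun u _ => List.getElem_mem _, fun u hu v hv hcu hcv hx => ?_⟩
    have hu' := hidx u hu
    have hv' := hidx v hv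
    have hcu' : (records cl)[idx u].kind.center = true := by rw [hu']; exact hcu
    have hcv' : (records cl)[idx v].kind.center = true := by rw [hv']; exact hcv
    have h := hp _ (Finset.mem_image_of_mem _ ((hc _).2 hcu')) _
      (Finset.mem_image_of_mem _ ((hc _).2 hcv')) ?_
    · have h1 := hmem _ (p (closedNbhd (clauseGraph cl) (idx u))) hcu'
      have h2 := hmem _ (p (closedNbhd (clauseGraph cl) (idx v))) hcu'
      have h3 := hmem _ (p (closedNbhd (clauseGraph cl) (idx u))) hcv'
      have h4 := hmem _ (p (closedNbhd (clauseGraph cl) (idx v))) hcv'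
      rw [h1, h2, h3, h4, ← Bool.eq_iff_iff, ← Bool.eq_iff_iff, hu', hv'] at h
      exact h
    · intro e
      obtain ⟨x, hx, hne⟩ := hx
      have h1 := hmem _ (idx x) hcu'
      have h2 := hmem _ (idx x) hcv'
      rw [e, h2, ← Bool.eq_iff_iff, hu', hv', hidx x hx] at h1
      exact hne h1.symm
  · rintro ⟨π, hπ, h⟩
    have hcen : ∀ C : Finset (Fin (records cl).length), ∃ i : Fin (records cl).length,
        C ∈ (clauseCenters cl).image (closedNbhd (clauseGraph cl)) →
        (records cl)[i].kind.center = true ∧ closedNbhd (clauseGraph cl) i = C := by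
      intro C
      by_cases h : C ∈ (clauseCenters cl).image (closedNbhd (clauseGraph cl))
      · obtain ⟨i, hi, h⟩ := Finset.mem_image.1 h
        exact ⟨i, fun _ => ⟨(hc _).1 hi, h⟩⟩
      · exact ⟨⟨0, hpos⟩, fun h' => absurd h' h⟩
    choose cen hcen using hcen
    refine ⟨fun C => idx (π (records cl)[cen C]), fun C hC D hD hCD => ?_⟩
    obtain ⟨hcC, eC⟩ := hcen C hC
    obtain ⟨hcD, eD⟩ := hcen D hD
    have h1 := h _ (List.getElem_mem (cen C).2) _ (List.getElem_mem (cen D).2) hcC hcD ?_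
    · have a1 := hmem (cen C) (idx (π (records cl)[cen C])) hcC
      have a2 := hmem (cen D) (idx (π (records cl)[cen C])) hcD
      have a3 := hmem (cen C) (idx (π (records cl)[cen D])) hcC
      have a4 := hmem (cen D) (idx (π (records cl)[cen D])) hcD
      have bC : (records cl)[idx (π (records cl)[cen C])] = π (records cl)[cen C] :=
        hidx _ (hπ _ (List.getElem_mem _))
      have bD : (records cl)[idx (π (records cl)[cen D])] = π (records cl)[cen D] :=
        hidx _ (hπ _ (List.getElem_mem _))
      rw [eC] at a1 a3
      rw [eD] at a2 a4
      rw [bC] at a1 a2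
      rw [bD] at a3 a4
      beta_reduce
      rw [a1, a2, a3, a4, ← Bool.eq_iff_iff, ← Bool.eq_iff_iff]
      exact h1
    · by_contra! hx
      apply hCD
      ext x
      have h1 := hmem (cen C) x hcC
      have h2 := hmem (cen D) x hcD
      have h3 := hx _ (List.getElem_mem x.2)
      rw [eC] at h1
      rw [eD] at h2
      rw [h1, h2, ← Bool.eq_iff_iff]
      exact h3

/-- The instance of N-NCTD that belongs to a formula. -/
def reduction (φ : Formula) : Instance where
  N := (records φ.raw).length
  G := clauseGraph φ.raw
  centers := clauseCenters φ.raw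
  k := 1
  k_pos := one_pos

theorem reduction_isYes_iff (φ : Formula) : (reduction φ).IsYes ↔ Teachable φ.raw :=
  nctd_clauseGraph_le_one_iff φ.raw

theorem reduction_correct (φ : Formula) : φ.IsSat ↔ (reduction φ).IsYes := by
  rw [reduction_isYes_iff, Formula.isSat_iff]
  exact ⟨Teachable.of_rawSat, Teachable.rawSat⟩

/-! ### The encoded instance as a word -/

theorem map_finRange_getElem {A B : Type} (L : List A) (f : A → B) :
    (List.finRange L.length).map (fun i => f L[i]) = L.map f := by
  apply List.ext_getElem <;> simp

theorem reduction_encode (φ : Formula) : (reduction φ).encode =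
    List.replicate (records φ.raw).length (some true) ++ [none] ++
    (records φ.raw).flatMap (fun u => (records φ.raw).map fun v => some (u.bit v)) ++
    (records φ.raw).map (fun v => some v.kind.center) ++ [none] ++ [some true] := by
  set R := records φ.raw with hR
  have h1 := map_finRange_getElem R (fun v => some v.kind.center)
  have h2 := map_finRange_getElem R (fun u => R.map fun v => some (u.bit v))
  have h3 : ∀ u : Rec, (List.finRange R.length).map (fun i => some (u.bit R[i])) = _ :=
    fun u => map_finRange_getElem R (fun v => some (u.bit v))
  have h4 : (Computability.encodeNat 1).map some = [some true] := rfl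
  have h5 : ∀ v, decide (v ∈ clauseCenters φ.raw) = R[v].kind.center := by
    intro v
    rw [Bool.eq_iff_iff, decide_eq_true_iff, clauseCenters, Finset.mem_filter]
    exact and_iff_right (Finset.mem_univ _)
  rw [List.flatMap_def, ← h1, ← h2, ← h4]
  simp only [← h3, ← List.flatMap_def]
  simp only [Instance.encode, reduction, clauseGraph, ← hR, Bool.decide_eq_true, ← h5]
  rfl

/-! ### A stack program for the reduction -/

namespace Prog

section Macros

variable {K : Type} [DecidableEq K]

/-- Move the stack `a` to the stack `b`, reversing it. -/
def pour (a b : K) : Prog K := loop a (fun _ => true) (fun x => push b x)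

/-- Empty the stack `a`. -/
def clear (a : K) : Prog K := loop a (fun _ => true) (fun _ => skip)

/-- Copy the stack `a` to the stack `c` by means of the stack `t`. -/
def copy (a c t : K) : Prog K :=
  seq (pour a t) (loop t (fun _ => true) fun x => seq (push a x) (push c x))

/-- Push the bits of a list, the first one first. -/
def emit (r : K) : List Bool → Prog K
  | [] => skip
  | b :: bs => seq (push r (some b)) (emit r bs)

/-- Execute a list of programs. -/
def seqs : List (Prog K) → Prog K
  | [] => skip
  | p :: ps => seq p (seqs ps)

theorem Runs.of_eq {p : Prog K} {s s' s'' : K → List Sym} {t t' : ℕ} (h : Runs p s s' t)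
    (hs : s' = s'') (ht : t = t') : Runs p s s'' t' := hs ▸ ht ▸ h

theorem runs_clear (a : K) (s : K → List Sym) :
    Runs (clear a) s (Function.update s a []) ((s a).length + 1) := by
  generalize h : s a = l
  induction l generalizing s with
  | nil =>
    rw [← h, Function.update_eq_self, h]
    exact Runs.loop_nil h
  | cons x l ih =>
    have h2 := ih (Function.update s a l) (Function.update_self ..)
    rw [Function.update_idem] at h2
    have := Runs.loop_cons (c := fun _ => true) h rfl (Runs.skip _) h2
    rwa [zero_add] at this

theorem runs_pour {a b : K} (hab : a ≠ b) (s : K → List Sym) :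
    Runs (pour a b) s (Function.update (Function.update s a []) b ((s a).reverse ++ s b))
      ((s a).length + 1) := by
  generalize h : s a = l
  induction l generalizing s with
  | nil =>
    rw [← h, Function.update_eq_self, h, List.reverse_nil, List.nil_append,
      Function.update_eq_self]
    exact Runs.loop_nil h
  | cons x l ih =>
    have h2 := ih (Function.update (Function.update s a l) b (x :: s b)) (by simp [hab])
    have h3 := Runs.push b x (Function.update s a l)
    rw [Function.update_of_ne hab.symm] at h3
    have := Runs.loop_cons (c := fun _ => true) h rfl h3 h2
    refine this.of_eq ?_ (by rw [zero_add, List.length_cons])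
    funext k
    by_cases hb : k = b
    · subst hb; simp
    · by_cases ha : k = a
      · subst ha; simp [hb]
      · simp [ha, hb]

/-- Two reversals, via `t`, restore `a` and put its contents in the original order on `c`. -/
theorem runs_copy {a c t : K} (hac : a ≠ c) (hat : a ≠ t) (hct : c ≠ t) (s : K → List Sym)
    (ht : s t = []) :
    Runs (copy a c t) s (Function.update s c (s a ++ s c)) (2 * (s a).length + 2) := by
  have h1 := runs_pour hat s
  have h2 : ∀ (l : List Sym) (s : K → List Sym), s t = l →
      Runs (loop t (fun _ => true) fun x => seq (push a x) (push c x)) s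
        (Function.update (Function.update (Function.update s t []) a (l.reverse ++ s a)) c
          (l.reverse ++ s c)) (l.length + 1) := by
    intro l
    induction l with
    | nil =>
      intro s h
      rw [← h, Function.update_eq_self, h, List.reverse_nil, List.nil_append,
        Function.update_eq_self, List.nil_append, Function.update_eq_self]
      exact Runs.loop_nil h
    | cons x l ih =>
      intro s h
      have h3 := (Runs.push a x (Function.update s t l)).seq (Runs.push c x _)
      have h4 := Runs.loop_cons (c := fun _ => true) h rfl h3 (ih _ (by simp [hat.symm, hct.symm]))
      refine h4.of_eq ?_ (by rw [zero_add, zero_add, List.length_cons])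
      funext k
      by_cases hc : k = c
      · subst hc; simp [hac.symm, hct]
      · by_cases ha : k = a
        · subst ha; simp [hc, hat]
        · by_cases htk : k = t
          · subst htk; simp [ha, hc]
          · simp [ha, hc, htk]
  have h3 := h1.seq (h2 _ _ rfl)
  simp only [Function.update_self, ht, List.append_nil, List.length_reverse] at h3
  refine h3.of_eq ?_ (by ring)
  · funext k
    by_cases hc : k = c
    · subst hc; simp [hac.symm, hct]
    · by_cases ha : k = a
      · subst ha; simp [hc, hat]
      · by_cases htk : k = t
        · subst htk; simp [ha, hc, ht]
        · simp [ha, hc, htk]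

theorem runs_emit (r : K) (bs : List Bool) (s : K → List Sym) :
    Runs (emit r bs) s (Function.update s r ((bs.map some).reverse ++ s r)) 0 := by
  induction bs generalizing s with
  | nil =>
    rw [List.map_nil, List.reverse_nil, List.nil_append, Function.update_eq_self]
    exact Runs.skip s
  | cons b bs ih =>
    have := (Runs.push r (some b) s).seq (ih _)
    refine this.of_eq ?_ rfl
    simp

end Macros

/-- The stacks of the program below, apart from the output stack. -/
inductive Stk : Type
  | inp | cols | back | lit | cmp | idx | cnt | tmp | rev
  deriving DecidableEq

instance : Fintype Stk :=
  ⟨⟨([.inp, .cols, .back, .lit, .cmp, .idx, .cnt, .tmp, .rev] : List Stk), by decide⟩, fun k => by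
    cases k <;> simp⟩

/-- The contents of the stacks. -/
structure Mem where
  out : List Sym
  inp : List Sym
  cols : List Sym
  back : List Sym
  lit : List Sym
  cmp : List Sym
  idx : List Sym
  cnt : List Sym
  tmp : List Sym
  rev : List Sym

/-- The contents of a stack. -/
def Mem.fn (m : Mem) : Option Stk → List Sym
  | none => m.out
  | some .inp => m.inp
  | some .cols => m.cols
  | some .back => m.back
  | some .lit => m.lit
  | some .cmp => m.cmp
  | some .idx => m.idx
  | some .cnt => m.cnt
  | some .tmp => m.tmp
  | some .rev => m.rev

/-- Change the contents of a stack. -/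
def Mem.set (m : Mem) (k : Option Stk) (l : List Sym) : Mem :=
  match k with
  | none => { m with out := l }
  | some .inp => { m with inp := l }
  | some .cols => { m with cols := l }
  | some .back => { m with back := l }
  | some .lit => { m with lit := l }
  | some .cmp => { m with cmp := l }
  | some .idx => { m with idx := l }
  | some .cnt => { m with cnt := l }
  | some .tmp => { m with tmp := l }
  | some .rev => { m with rev := l }

theorem Mem.update_fn (m : Mem) (k : Option Stk) (l : List Sym) :
    Function.update m.fn k l = (m.set k l).fn := by
  funext k'
  by_cases h : k' = k
  · subst h
    rw [Function.update_self]
    rcases k' with _ | k' <;> [rfl; (cases k' <;> rfl)]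
  · rw [Function.update_of_ne h]
    rcases k with _ | k <;> rcases k' with _ | k' <;> try cases k <;> try cases k'
    all_goals first | rfl | exact absurd rfl h | (cases k' <;> rfl)

/-- `Does p m m' t`: the program `p` leads from `m` to `m'` in at most `t` loop tests. -/
def Does (p : Prog (Option Stk)) (m m' : Mem) (t : ℕ) : Prop := ∃ t' ≤ t, Runs p m.fn m'.fn t'

namespace Does

variable {p q : Prog (Option Stk)} {m m' m'' : Mem} {t t' : ℕ}

theorem of_eq (h : Does p m m' t) (hm : m' = m'') (ht : t ≤ t') : Does p m m'' t' := by
  obtain ⟨n, hn, h⟩ := h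
  exact ⟨n, hn.trans ht, hm ▸ h⟩

theorem skip (m : Mem) : Does .skip m m 0 := ⟨0, le_rfl, .skip _⟩

theorem push (k : Option Stk) (a : Sym) (m : Mem) :
    Does (.push k a) m (m.set k (a :: m.fn k)) 0 :=
  ⟨0, le_rfl, m.update_fn k _ ▸ .push k a _⟩

theorem pop {k : Option Stk} {f : Option Sym → Prog (Option Stk)}
    (h : Does (f (m.fn k).head?) (m.set k (m.fn k).tail) m' t) : Does (.pop k f) m m' t := by
  obtain ⟨n, hn, h⟩ := h
  exact ⟨n, hn, .pop (m.update_fn k _ ▸ h)⟩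

theorem seq (h : Does p m m' t) (h' : Does q m' m'' t') : Does (.seq p q) m m'' (t + t') := by
  obtain ⟨n, hn, h⟩ := h
  obtain ⟨n', hn', h'⟩ := h'
  exact ⟨n + n', add_le_add hn hn', h.seq h'⟩

variable {k : Option Stk} {c : Sym → Bool} {b : Sym → Prog (Option Stk)} {a : Sym} {l : List Sym}

theorem loop_nil (h : m.fn k = []) : Does (.loop k c b) m m 1 := ⟨1, le_rfl, .loop_nil h⟩

theorem loop_exit (h : m.fn k = a :: l) (hc : c a = false) : Does (.loop k c b) m (m.set k l) 1 :=
  ⟨1, le_rfl, m.update_fn k _ ▸ .loop_exit h hc⟩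

theorem loop_cons (h : m.fn k = a :: l) (hc : c a = true) (h1 : Does (b a) (m.set k l) m' t)
    (h2 : Does (.loop k c b) m' m'' t') : Does (.loop k c b) m m'' (t + t' + 1) := by
  obtain ⟨n, hn, h1⟩ := h1
  obtain ⟨n', hn', h2⟩ := h2
  exact ⟨n + n' + 1, by omega, .loop_cons h hc (m.update_fn k _ ▸ h1) h2⟩

theorem clear (k : Option Stk) (m : Mem) :
    Does (Prog.clear k) m (m.set k []) ((m.fn k).length + 1) :=
  ⟨_, le_rfl, m.update_fn k _ ▸ runs_clear k _⟩

theorem pour {a b : Option Stk} (hab : a ≠ b) (m : Mem) :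
    Does (Prog.pour a b) m ((m.set a []).set b ((m.fn a).reverse ++ m.fn b))
      ((m.fn a).length + 1) := by
  refine ⟨_, le_rfl, ?_⟩
  rw [← Mem.update_fn, ← Mem.update_fn]
  exact runs_pour hab _

theorem copy {a c t : Option Stk} (hac : a ≠ c) (hat : a ≠ t) (hct : c ≠ t) (m : Mem)
    (ht : m.fn t = []) :
    Does (Prog.copy a c t) m (m.set c (m.fn a ++ m.fn c)) (2 * (m.fn a).length + 2) := by
  refine ⟨_, le_rfl, ?_⟩
  rw [← Mem.update_fn]
  exact runs_copy hac hat hct _ ht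

theorem emit (r : Option Stk) (bs : List Bool) (m : Mem) :
    Does (Prog.emit r bs) m (m.set r ((bs.map some).reverse ++ m.fn r)) 0 := by
  refine ⟨_, le_rfl, ?_⟩
  rw [← Mem.update_fn]
  exact runs_emit _ _ _

end Does

/-- The symbols marking a unary digit and the end of a counter. -/
abbrev one : Sym := some true

/-- The symbol at the bottom of a counter. -/
abbrev bot : Sym := some false

/-- The code of a literal. -/
def word (l : RawLiteral) : List Sym := some l.2 :: (List.replicate l.1 one ++ [none])

/-- The code of a clause. -/
def clauseWord (c : RawClause) : List Sym := word c.1 ++ (word c.2.1 ++ word c.2.2)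

/-- The code of a list of clauses. -/
def clausesWord (cl : List RawClause) : List Sym := cl.flatMap clauseWord

/-! ### Scanning a literal of a column -/

/-- Compare the literal under the head of `cols` with the one on `lit`, and write the bits of its
columns. -/
def litCol (p : Kind) (a : ℕ) (sgn : Sym) (b : ℕ) (fl : Bool) (x : Sym) : Prog (Option Stk) :=
  seq (push (some .back) x) <|
  seq (copy (some .lit) (some .cmp) (some .tmp)) <|
  seq (loop (some .cols) Option.isSome fun y =>
    seq (push (some .back) y) (pop (some .cmp) fun _ => skip)) <|
  seq (push (some .back) none) <|
  pop (some .cmp) fun e =>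
    seq (emit (some .rev) (Kind.regular.map fun q =>
      Kind.adj fl (a == b) (e == some bot && sgn != x) p q))
    (clear (some .cmp))

/-- The bits written by `litCol`. -/
def litBits (p : Kind) (a : ℕ) (sgn : Sym) (w : List Sym) (fl : Bool) (b : ℕ) (l : RawLiteral) :
    List Bool :=
  Kind.regular.map fun q =>
    Kind.adj fl (a == b) ((w.drop l.1).head? == some bot && sgn != some l.2) p q

theorem does_compare (v : ℕ) (rest : List Sym) (m : Mem)
    (hc : m.cols = List.replicate v one ++ none :: rest) :
    Does (loop (some .cols) Option.isSome fun y =>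
        seq (push (some .back) y) (pop (some .cmp) fun _ => skip)) m
      { m with cols := rest, back := List.replicate v one ++ m.back, cmp := m.cmp.drop v }
      (v + 1) := by
  induction v generalizing m with
  | zero => exact (Does.loop_exit (k := some .cols) hc rfl).of_eq rfl (by omega)
  | succ v ih =>
    have h1 : Does (seq (push (some .back) one) (pop (some .cmp) fun _ => skip))
        (m.set (some .cols) (List.replicate v one ++ none :: rest))
        { m with
          cols := List.replicate v one ++ none :: rest
          back := one :: m.back
          cmp := m.cmp.tail } (0 + 0) :=
      (Does.push _ _ _).seq (Does.pop (Does.skip _))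
    refine (Does.loop_cons (k := some .cols) hc rfl h1 (ih _ rfl)).of_eq ?_ (by omega)
    simp [List.replicate_succ', List.drop_tail]

/-- One symbol of a copy of `lit` is popped per unary digit of the scanned variable; the marker
`bot` is then on top iff the variables agree. The scanned literal is saved on `back`. Copying,
comparing and clearing cost at most 2B + 2, B + 1 and B + 1 tests. -/
theorem does_litCol (p : Kind) (a : ℕ) (sgn : Sym) (b : ℕ) (fl : Bool) (l : RawLiteral)
    (rest : List Sym) {B : ℕ} (m : Mem) (hc : m.cols = List.replicate l.1 one ++ none :: rest)
    (ht : m.tmp = []) (hm : m.cmp = []) (hB : m.lit.length ≤ B) (hl : l.1 ≤ B) :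
    Does (litCol p a sgn b fl (some l.2)) m
      { m with
        cols := rest
        back := (word l).reverse ++ m.back
        rev := ((litBits p a sgn m.lit fl b l).map some).reverse ++ m.rev } (4 * B + 4) := by
  have h1 := Does.push (some .back) (some l.2) m
  have h2 := Does.copy (a := some .lit) (c := some .cmp) (t := some .tmp) (by decide) (by decide)
    (by decide) (m.set (some .back) (some l.2 :: m.fn (some .back))) ht
  have h3 := does_compare l.1 rest ((m.set (some .back) (some l.2 :: m.fn (some .back))).set
    (some .cmp) (m.lit ++ m.cmp)) hc
  have h4 := Does.push (some .back) none
    { m with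
      cols := rest
      back := List.replicate l.1 one ++ some l.2 :: m.back
      cmp := (m.lit ++ m.cmp).drop l.1 }
  have h5 := Does.emit (some .rev) (litBits p a sgn m.lit fl b l)
    { m with
      cols := rest
      back := none :: (List.replicate l.1 one ++ some l.2 :: m.back)
      cmp := ((m.lit ++ m.cmp).drop l.1).tail }
  have h6 := Does.clear (some .cmp)
    { m with
      cols := rest
      back := none :: (List.replicate l.1 one ++ some l.2 :: m.back)
      cmp := ((m.lit ++ m.cmp).drop l.1).tail
      rev := ((litBits p a sgn m.lit fl b l).map some).reverse ++ m.rev }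
  have h7 := Does.pop (k := some .cmp) (m := { m with
      cols := rest
      back := none :: (List.replicate l.1 one ++ some l.2 :: m.back)
      cmp := (m.lit ++ m.cmp).drop l.1 })
    (f := fun e => seq (Prog.emit (some .rev) (Kind.regular.map fun q =>
      Kind.adj fl (a == b) (e == some bot && sgn != some l.2) p q)) (Prog.clear (some .cmp)))
    (t := 0 + ((((m.lit ++ m.cmp).drop l.1).tail).length + 1)) (by
      simp only [Mem.fn]
      rw [hm, List.append_nil] at *
      exact h5.seq h6)
  refine (h1.seq (h2.seq (h3.seq (h4.seq h7)))).of_eq ?_ ?_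
  · simp [Mem.set, word, hm]
  · simp only [Mem.fn, Mem.set, hm, List.append_nil, List.length_tail, List.length_drop]
    omega

/-! ### Scanning all columns -/

/-- Write the bits of the columns of a clause, the first symbol `x` of which was read. -/
def clauseCol (p : Kind) (a : ℕ) (sgn x : Sym) : Prog (Option Stk) :=
  pop (some .cnt) fun fl =>
    seq (litCol p a sgn 0 (fl == some bot) x) <| pop (some .cols) fun y =>
    seq (litCol p a sgn 1 (fl == some bot) (y.getD none)) <| pop (some .cols) fun z =>
    litCol p a sgn 2 (fl == some bot) (z.getD none)

/-- The bits written by `clauseCol`. -/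
def clauseBits (p : Kind) (a : ℕ) (sgn : Sym) (w : List Sym) (fl : Bool) (c : RawClause) :
    List Bool :=
  c.occs.flatMap fun o => litBits p a sgn w fl o.1 o.2

/-- The bits of all columns. -/
def colBits (p : Kind) (a : ℕ) (sgn : Sym) (w : List Sym) : List Sym → List RawClause → List Bool
  | _, [] => []
  | i, c :: cl => clauseBits p a sgn w (i.head? == some bot) c ++ colBits p a sgn w i.tail cl

/-- The sign of the first literal has already been consumed by the test of the enclosing loop,
whence the form of `hc`. The signs of the other two are popped explicitly; the default `none` in
`clauseCol` does not occur on a well-formed word. -/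
theorem does_clauseCol (p : Kind) (a : ℕ) (sgn : Sym) (c : RawClause)
    (rest : List Sym) {B : ℕ} (m : Mem)
    (hc : some c.1.2 :: m.cols = clauseWord c ++ rest)
    (ht : m.tmp = []) (hm : m.cmp = []) (hB : m.lit.length ≤ B)
    (hl : c.1.1 ≤ B ∧ c.2.1.1 ≤ B ∧ c.2.2.1 ≤ B) :
    Does (clauseCol p a sgn (some c.1.2)) m
      { m with
        cols := rest
        cnt := m.cnt.tail
        back := (clauseWord c).reverse ++ m.back
        rev := ((clauseBits p a sgn m.lit (m.cnt.head? == some bot) c).map some).reverse ++ m.rev }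
      (12 * B + 12) := by
  obtain ⟨l₁, l₂, l₃⟩ := c
  obtain ⟨hl1, hl2, hl3⟩ := hl
  set fl := m.cnt.head? == some bot with hfl
  have h1 := does_litCol p a sgn 0 fl l₁ (word l₂ ++ (word l₃ ++ rest))
    (m.set (some .cnt) m.cnt.tail) (by
      simp [clauseWord, word] at hc
      simp [Mem.set, hc, word]) ht hm hB hl1
  have h2 := does_litCol p a sgn 1 fl l₂ (word l₃ ++ rest)
    { m with
      cols := List.replicate l₂.1 one ++ [none] ++ (word l₃ ++ rest)
      cnt := m.cnt.tail
      back := (word l₁).reverse ++ m.back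
      rev := ((litBits p a sgn m.lit fl 0 l₁).map some).reverse ++ m.rev } (by simp) ht hm hB hl2
  have h3 := does_litCol p a sgn 2 fl l₃ rest
    { m with
      cols := List.replicate l₃.1 one ++ [none] ++ rest
      cnt := m.cnt.tail
      back := (word l₂).reverse ++ ((word l₁).reverse ++ m.back)
      rev := ((litBits p a sgn m.lit fl 1 l₂).map some).reverse ++
        (((litBits p a sgn m.lit fl 0 l₁).map some).reverse ++ m.rev) } (by simp) ht hm hB hl3
  have h4 := Does.pop (k := some .cols) (f := fun z => litCol p a sgn 2 fl (z.getD none))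
    (m := { m with
      cols := word l₃ ++ rest
      cnt := m.cnt.tail
      back := (word l₂).reverse ++ ((word l₁).reverse ++ m.back)
      rev := ((litBits p a sgn m.lit fl 1 l₂).map some).reverse ++
        (((litBits p a sgn m.lit fl 0 l₁).map some).reverse ++ m.rev) }) h3
  have h5 := Does.pop (k := some .cols) (f := fun y =>
      seq (litCol p a sgn 1 fl (y.getD none)) <| pop (some .cols) fun z =>
      litCol p a sgn 2 fl (z.getD none))
    (m := { m with
      cols := word l₂ ++ (word l₃ ++ rest)
      cnt := m.cnt.tail
      back := (word l₁).reverse ++ m.back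
      rev := ((litBits p a sgn m.lit fl 0 l₁).map some).reverse ++ m.rev }) (h2.seq h4)
  refine (Does.pop (k := some .cnt) (h1.seq h5)).of_eq ?_ (by omega)
  simp [clauseWord, clauseBits, RawClause.occs]

theorem does_colLoop (p : Kind) (a : ℕ) (sgn : Sym) {B : ℕ} (cl : List RawClause)
    (hl : ∀ c ∈ cl, c.1.1 ≤ B ∧ c.2.1.1 ≤ B ∧ c.2.2.1 ≤ B) (m : Mem)
    (hc : m.cols = clausesWord cl) (ht : m.tmp = []) (hm : m.cmp = []) (hB : m.lit.length ≤ B) :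
    Does (loop (some .cols) (fun _ => true) fun x => clauseCol p a sgn x) m
      { m with
        cols := []
        cnt := m.cnt.drop cl.length
        back := (clausesWord cl).reverse ++ m.back
        rev := ((colBits p a sgn m.lit m.cnt cl).map some).reverse ++ m.rev }
      (cl.length * (12 * B + 13) + 1) := by
  induction cl generalizing m with
  | nil =>
    refine (Does.loop_nil (k := some .cols) hc).of_eq ?_ (by simp)
    obtain ⟨⟩ := m
    simp_all [clausesWord, colBits]
  | cons c cl ih =>
    have hc' : m.cols = some c.1.2 :: (List.replicate c.1.1 one ++ [none] ++
        (word c.2.1 ++ (word c.2.2 ++ clausesWord cl))) := by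
      rw [hc]; simp [clausesWord, clauseWord, word]
    have h1 := does_clauseCol p a sgn c (clausesWord cl) (B := B)
      (m.set (some .cols) (List.replicate c.1.1 one ++ [none] ++
        (word c.2.1 ++ (word c.2.2 ++ clausesWord cl))))
      (by simp [Mem.set, clauseWord, word]) ht hm hB (hl c List.mem_cons_self)
    have h2 := ih (fun c hc => hl c (List.mem_cons_of_mem _ hc)) { m with
        cols := clausesWord cl
        cnt := m.cnt.tail
        back := (clauseWord c).reverse ++ m.back
        rev := ((clauseBits p a sgn m.lit (m.cnt.head? == some bot) c).map some).reverse ++ m.rev }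
      rfl ht hm hB
    refine (Does.loop_cons (k := some .cols) hc' rfl h1 h2).of_eq ?_ ?_
    · simp [clausesWord, colBits, List.drop_tail]
    · rw [List.length_cons, add_mul]
      omega

/-! ### Writing rows -/

/-- Write a row of the adjacency matrix. -/
def row (p : Kind) (a : ℕ) (sgn : Sym) : Prog (Option Stk) :=
  seq (emit (some .rev) (Kind.special.map (Kind.adj true true false p))) <|
  seq (copy (some .idx) (some .cnt) (some .tmp)) <|
  seq (loop (some .cols) (fun _ => true) fun x => clauseCol p a sgn x) <|
  seq (pour (some .back) (some .cols)) (clear (some .cnt))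

/-- The bits of a row. -/
def rowBits (p : Kind) (a : ℕ) (sgn : Sym) (w i : List Sym) (cl : List RawClause) : List Bool :=
  Kind.special.map (Kind.adj true true false p) ++ colBits p a sgn w i cl

/-- The properties of the stacks that hold between rows. -/
structure Good (cl : List RawClause) (B : ℕ) (m : Mem) : Prop where
  cols : m.cols = clausesWord cl
  back : m.back = []
  cmp : m.cmp = []
  cnt : m.cnt = []
  tmp : m.tmp = []
  bound : ∀ c ∈ cl, c.1.1 < B ∧ c.2.1.1 < B ∧ c.2.2.1 < B
  length : cl.length ≤ B
  length_cols : (clausesWord cl).length ≤ B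

/-- A bound for the time needed to write a row. -/
def rowTime (B : ℕ) : ℕ := 12 * B ^ 2 + 17 * B + 5

/-- The counter `cnt` starts as a copy of `idx` and loses a symbol per clause, so its marker appears
exactly at the clause of the row. The scan moves the formula reversed to `back`, and the final
`pour` restores it for the next row. -/
theorem does_row (p : Kind) (a : ℕ) (sgn : Sym) {B : ℕ} {cl : List RawClause} (m : Mem)
    (h : Good cl B m) (hl : m.lit.length ≤ B) (hi : m.idx.length ≤ B) :
    Does (row p a sgn) m
      { m with rev := ((rowBits p a sgn m.lit m.idx cl).map some).reverse ++ m.rev }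
      (rowTime B) := by
  set r₁ := ((Kind.special.map (Kind.adj true true false p)).map some).reverse ++ m.rev with hr₁
  set r₂ := ((colBits p a sgn m.lit m.idx cl).map some).reverse ++ r₁ with hr₂
  have h1 := Does.emit (some .rev) (Kind.special.map (Kind.adj true true false p)) m
  have h2 := Does.copy (a := some .idx) (c := some .cnt) (t := some .tmp) (by decide) (by decide)
    (by decide) { m with rev := r₁ } h.tmp
  have h3 := does_colLoop p a sgn (B := B) cl
    (fun c hc => ⟨(h.bound c hc).1.le, (h.bound c hc).2.1.le, (h.bound c hc).2.2.le⟩)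
    { m with rev := r₁, cnt := m.idx } h.cols h.tmp h.cmp hl
  have h4 := Does.pour (a := some .back) (b := some .cols) (by decide)
    { m with
      cols := []
      cnt := m.idx.drop cl.length
      back := (clausesWord cl).reverse ++ m.back
      rev := r₂ }
  have h5 := Does.clear (some .cnt)
    { m with
      cols := clausesWord cl
      cnt := m.idx.drop cl.length
      back := []
      rev := r₂ }
  simp only [Mem.fn, Mem.set, h.cnt, h.back, List.append_nil,
    List.reverse_reverse] at h1 h2 h3 h4 h5
  refine (h1.seq (h2.seq (h3.seq (h4.seq h5)))).of_eq ?_ ?_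
  · obtain ⟨⟩ := m
    have e1 := h.cols
    have e2 := h.back
    have e3 := h.cnt
    simp_all [rowBits]
  · have e1 : cl.length * (12 * B + 13) ≤ B * (12 * B + 13) := Nat.mul_le_mul_right _ h.length
    have e2 := h.length_cols
    simp only [List.length_drop, List.length_reverse, rowTime]
    nlinarith [Nat.sub_le m.idx.length cl.length]

theorem Good.set_rev {cl : List RawClause} {B : ℕ} {m : Mem} (h : Good cl B m) (r : List Sym) :
    Good cl B { m with rev := r } :=
  ⟨h.cols, h.back, h.cmp, h.cnt, h.tmp, h.bound, h.length, h.length_cols⟩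

theorem does_rows (a : ℕ) (sgn : Sym) {B : ℕ} {cl : List RawClause} (ps : List Kind) (m : Mem)
    (h : Good cl B m) (hl : m.lit.length ≤ B) (hi : m.idx.length ≤ B) :
    Does (seqs (ps.map fun p => row p a sgn)) m
      { m with
        rev := ((ps.flatMap fun p => rowBits p a sgn m.lit m.idx cl).map some).reverse ++ m.rev }
      (ps.length * rowTime B) := by
  induction ps generalizing m with
  | nil => exact (Does.skip m).of_eq (by simp) (by simp)
  | cons p ps ih =>
    refine ((does_row p a sgn m h hl hi).seq (ih _ (h.set_rev _) hl hi)).of_eq ?_ ?_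
    · simp
    · rw [List.length_cons]
      linarith

/-! ### Scanning the occurrences of literals for the rows -/

/-- Write the rows that belong to the literal under the head of `inp`. -/
def litRows (a : ℕ) (x : Sym) : Prog (Option Stk) :=
  seq (push (some .lit) bot) <|
  seq (loop (some .inp) Option.isSome fun y => push (some .lit) y) <|
  seq (seqs (Kind.regular.map fun p => row p a x)) (clear (some .lit))

/-- The bits of the rows of a literal. -/
def litRowsBits (i : List Sym) (cl : List RawClause) (a : ℕ) (l : RawLiteral) : List Bool :=
  Kind.regular.flatMap fun p =>
    rowBits p a (some l.2) (List.replicate l.1 one ++ [bot]) i cl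

theorem does_readVar (v : ℕ) (rest : List Sym) (m : Mem)
    (hc : m.inp = List.replicate v one ++ none :: rest) :
    Does (loop (some .inp) Option.isSome fun y => push (some .lit) y) m
      { m with inp := rest, lit := List.replicate v one ++ m.lit } (v + 1) := by
  induction v generalizing m with
  | zero => exact (Does.loop_exit (k := some .inp) hc rfl).of_eq rfl (by omega)
  | succ v ih =>
    have h1 := Does.push (some .lit) one
      (m.set (some .inp) (List.replicate v one ++ none :: rest))
    refine (Does.loop_cons (k := some .inp) hc rfl h1 (ih _ rfl)).of_eq ?_ (by omega)
    simp [Mem.set, Mem.fn, List.replicate_succ']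

/-- The bound on the variable is strict because `lit` also holds the marker `bot`. -/
theorem does_litRows (a : ℕ) (l : RawLiteral) (rest : List Sym) {B : ℕ} {cl : List RawClause}
    (m : Mem) (h : Good cl B m) (hlit : m.lit = []) (hi : m.idx.length ≤ B) (hl : l.1 < B)
    (hc : m.inp = List.replicate l.1 one ++ none :: rest) :
    Does (litRows a (some l.2)) m
      { m with
        inp := rest
        rev := ((litRowsBits m.idx cl a l).map some).reverse ++ m.rev }
      (6 * rowTime B + 2 * B + 2) := by
  have h1 := Does.push (some .lit) bot m
  have h2 := does_readVar l.1 rest { m with lit := [bot] } hc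
  have h3 := does_rows a (some l.2) (B := B) (cl := cl) Kind.regular
    { m with inp := rest, lit := List.replicate l.1 one ++ [bot] }
    ⟨h.cols, h.back, h.cmp, h.cnt, h.tmp, h.bound, h.length, h.length_cols⟩
    (by simpa using hl) hi
  have h4 := Does.clear (some .lit)
    { m with
      inp := rest
      lit := List.replicate l.1 one ++ [bot]
      rev := ((litRowsBits m.idx cl a l).map some).reverse ++ m.rev }
  simp only [Mem.fn, Mem.set, hlit] at h1 h2 h3 h4
  refine (h1.seq (h2.seq (h3.seq h4))).of_eq ?_ ?_
  · rw [← hlit]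
  · simp [Kind.regular]
    omega

/-- Write the rows that belong to a clause, the first symbol `x` of which was read. -/
def clauseRows (x : Sym) : Prog (Option Stk) :=
  seq (litRows 0 x) <| pop (some .inp) fun y =>
  seq (litRows 1 (y.getD none)) <| pop (some .inp) fun z =>
  seq (litRows 2 (z.getD none)) (push (some .idx) one)

/-- The bits of the rows of a clause. -/
def clauseRowsBits (i : List Sym) (cl : List RawClause) (c : RawClause) : List Bool :=
  c.occs.flatMap fun o => litRowsBits i cl o.1 o.2

/-- The bits of the rows of a list of clauses. -/
def clausesRowsBits (cl : List RawClause) : List Sym → List RawClause → List Bool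
  | _, [] => []
  | i, c :: rl => clauseRowsBits i cl c ++ clausesRowsBits cl (one :: i) rl

theorem does_clauseRows (c : RawClause) (rest : List Sym) {B : ℕ} {cl : List RawClause}
    (m : Mem) (h : Good cl B m) (hlit : m.lit = []) (hi : m.idx.length ≤ B)
    (hl : c.1.1 < B ∧ c.2.1.1 < B ∧ c.2.2.1 < B)
    (hc : some c.1.2 :: m.inp = clauseWord c ++ rest) :
    Does (clauseRows (some c.1.2)) m
      { m with
        inp := rest
        idx := one :: m.idx
        rev := ((clauseRowsBits m.idx cl c).map some).reverse ++ m.rev }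
      (3 * (6 * rowTime B + 2 * B + 2)) := by
  obtain ⟨l₁, l₂, l₃⟩ := c
  obtain ⟨hl1, hl2, hl3⟩ := hl
  have h1 := does_litRows 0 l₁ (word l₂ ++ (word l₃ ++ rest)) m h hlit hi hl1 (by
      simp [clauseWord, word] at hc
      simp [hc, word])
  have h2 := does_litRows 1 l₂ (word l₃ ++ rest) (B := B) (cl := cl)
    { m with
      inp := List.replicate l₂.1 one ++ [none] ++ (word l₃ ++ rest)
      rev := ((litRowsBits m.idx cl 0 l₁).map some).reverse ++ m.rev }
    ⟨h.cols, h.back, h.cmp, h.cnt, h.tmp, h.bound, h.length, h.length_cols⟩ hlit hi hl2 (by simp)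
  have h3 := does_litRows 2 l₃ rest (B := B) (cl := cl)
    { m with
      inp := List.replicate l₃.1 one ++ [none] ++ rest
      rev := ((litRowsBits m.idx cl 1 l₂).map some).reverse ++
        (((litRowsBits m.idx cl 0 l₁).map some).reverse ++ m.rev) }
    ⟨h.cols, h.back, h.cmp, h.cnt, h.tmp, h.bound, h.length, h.length_cols⟩ hlit hi hl3 (by simp)
  have h4 := Does.push (some .idx) one
    { m with
      inp := rest
      rev := ((litRowsBits m.idx cl 2 l₃).map some).reverse ++
        (((litRowsBits m.idx cl 1 l₂).map some).reverse ++
        (((litRowsBits m.idx cl 0 l₁).map some).reverse ++ m.rev)) }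
  have h5 := Does.pop (k := some .inp)
    (f := fun z => seq (litRows 2 (z.getD none)) (push (some .idx) one))
    (m := { m with
      inp := word l₃ ++ rest
      rev := ((litRowsBits m.idx cl 1 l₂).map some).reverse ++
        (((litRowsBits m.idx cl 0 l₁).map some).reverse ++ m.rev) }) (h3.seq h4)
  have h6 := Does.pop (k := some .inp) (f := fun y =>
      seq (litRows 1 (y.getD none)) <| pop (some .inp) fun z =>
      seq (litRows 2 (z.getD none)) (push (some .idx) one))
    (m := { m with
      inp := word l₂ ++ (word l₃ ++ rest)
      rev := ((litRowsBits m.idx cl 0 l₁).map some).reverse ++ m.rev }) (h2.seq h5)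
  refine (h1.seq h6).of_eq ?_ (by omega)
  simp [Mem.fn, Mem.set, clauseRowsBits, RawClause.occs]

/-- Here `rl` are the clauses whose rows are still to be written, while every row scans the whole of
`cl`. -/
theorem does_rowLoop {B : ℕ} {cl : List RawClause} (rl : List RawClause)
    (hl : ∀ c ∈ rl, c.1.1 < B ∧ c.2.1.1 < B ∧ c.2.2.1 < B) (m : Mem) (h : Good cl B m)
    (hlit : m.lit = []) (hi : m.idx.length + rl.length ≤ B) (hc : m.inp = clausesWord rl) :
    Does (loop (some .inp) (fun _ => true) clauseRows) m
      { m with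
        inp := []
        idx := List.replicate rl.length one ++ m.idx
        rev := ((clausesRowsBits cl m.idx rl).map some).reverse ++ m.rev }
      (rl.length * (3 * (6 * rowTime B + 2 * B + 2) + 1) + 1) := by
  induction rl generalizing m with
  | nil =>
    refine (Does.loop_nil (k := some .inp) hc).of_eq ?_ (by simp)
    obtain ⟨⟩ := m
    simp_all [clausesWord, clausesRowsBits]
  | cons c rl ih =>
    have hc' : m.inp = some c.1.2 :: (List.replicate c.1.1 one ++ [none] ++
        (word c.2.1 ++ (word c.2.2 ++ clausesWord rl))) := by
      rw [hc]; simp [clausesWord, clauseWord, word]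
    rw [List.length_cons] at hi
    have h1 := does_clauseRows c (clausesWord rl) (B := B) (cl := cl)
      (m.set (some .inp) (List.replicate c.1.1 one ++ [none] ++
        (word c.2.1 ++ (word c.2.2 ++ clausesWord rl))))
      ⟨h.cols, h.back, h.cmp, h.cnt, h.tmp, h.bound, h.length, h.length_cols⟩ hlit
      (show m.idx.length ≤ B by omega) (hl c List.mem_cons_self)
      (by simp [Mem.set, clauseWord, word])
    have h2 := ih (fun c hc => hl c (List.mem_cons_of_mem _ hc)) { m with
        inp := clausesWord rl
        idx := one :: m.idx
        rev := ((clauseRowsBits m.idx cl c).map some).reverse ++ m.rev }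
      ⟨h.cols, h.back, h.cmp, h.cnt, h.tmp, h.bound, h.length, h.length_cols⟩ hlit
      (by simp only [List.length_cons]; omega) rfl
    refine (Does.loop_cons (k := some .inp) hc' rfl h1 h2).of_eq ?_ ?_
    · simp [clausesRowsBits, List.replicate_succ']
    · rw [List.length_cons, add_mul]
      omega

/-! ### The bits in terms of the graph -/

/-- Justifies the unary equality tests: with too few pops a digit is on top, with too many the stack
is empty. -/
theorem head_drop_counter (j k : ℕ) :
    (((List.replicate j one ++ [bot]).drop k).head? == some bot) = (j == k) := by
  rw [List.head?_drop, Bool.eq_iff_iff, beq_iff_eq, beq_iff_eq]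
  rcases lt_trichotomy k j with h | rfl | h
  · rw [List.getElem?_append_left (by simpa using h)]
    simp [h, h.ne']
  · simp
  · rw [List.getElem?_eq_none (by simpa using h)]
    simp [h.ne]

theorem colBits_regular (p : Kind) (j a : ℕ) (l : RawLiteral) (cl : List RawClause) (k : ℕ) :
    colBits p a (some l.2) (List.replicate l.1 one ++ [bot])
        ((List.replicate j one ++ [bot]).drop k) cl =
      ((cl.zipIdx k).flatMap fun x => block x.2 x.1).map (Rec.bit ⟨p, j, a, l⟩) := by
  induction cl generalizing k with
  | nil => rfl
  | cons c cl ih =>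
    rw [colBits, List.tail_drop, ih, List.zipIdx_cons, List.flatMap_cons, List.map_append,
      head_drop_counter]
    congr 1
    have hs : ∀ s s' : Bool, (some s != some s') = (s != s') := by decide
    simp only [clauseBits, block, List.map_flatMap, List.map_map, litBits, head_drop_counter, hs]
    rfl

/-- The comparisons made by the program are meaningless in special rows, but by `Kind.adj_special`
their outcome is irrelevant; `w`, `i`, `a` and `sgn` are therefore arbitrary. -/
theorem colBits_special {p : Kind} (hp : p ∈ Kind.special) (cl : List RawClause) (k : ℕ)
    (w i : List Sym) (a : ℕ) (sgn : Sym) :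
    colBits p a sgn w i cl =
      ((cl.zipIdx k).flatMap fun x => block x.2 x.1).map (Rec.bit (Rec.spec p)) := by
  induction cl generalizing k i with
  | nil => rfl
  | cons c cl ih =>
    rw [colBits, ih (k + 1), List.zipIdx_cons, List.flatMap_cons, List.map_append]
    congr 1
    simp only [clauseBits, block, List.map_flatMap, List.map_map, litBits]
    refine congrArg (fun f => List.flatMap f _) (funext fun o => ?_)
    refine List.map_congr_left fun q hq => ?_
    exact (Kind.adj_special _ _ _ (Or.inl ⟨hp, hq⟩)).trans
      (Kind.adj_special _ _ _ (Or.inl ⟨hp, hq⟩)).symm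

theorem rowBits_special {p : Kind} (hp : p ∈ Kind.special) (cl : List RawClause)
    (w i : List Sym) (a : ℕ) (sgn : Sym) :
    rowBits p a sgn w i cl = (records cl).map (Rec.bit (Rec.spec p)) := by
  rw [rowBits, records, List.map_append, colBits_special hp cl 0, List.map_map]
  rfl

theorem rowBits_regular {p : Kind} (hp : p ∈ Kind.regular) (j a : ℕ) (l : RawLiteral)
    (cl : List RawClause) :
    rowBits p a (some l.2) (List.replicate l.1 one ++ [bot]) (List.replicate j one ++ [bot]) cl =
      (records cl).map (Rec.bit ⟨p, j, a, l⟩) := by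
  have h := colBits_regular p j a l cl 0
  rw [List.drop_zero] at h
  rw [rowBits, records, List.map_append, h, List.map_map]
  congr 1
  refine List.map_congr_left fun q hq => ?_
  exact (Kind.adj_special _ _ _ (Or.inr ⟨hp, hq⟩)).symm

theorem clausesRowsBits_eq (cl rl : List RawClause) (k : ℕ) :
    clausesRowsBits cl (List.replicate k one ++ [bot]) rl =
      ((rl.zipIdx k).flatMap fun x => block x.2 x.1).flatMap
        fun r => (records cl).map (Rec.bit r) := by
  induction rl generalizing k with
  | nil => rfl
  | cons c rl ih =>
    have h := ih (k + 1)
    rw [List.replicate_succ, List.cons_append] at h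
    rw [clausesRowsBits, h, List.zipIdx_cons, List.flatMap_cons, List.flatMap_append]
    congr 1
    simp only [clauseRowsBits, litRowsBits, block, List.flatMap_assoc, List.flatMap_map]
    refine congrArg (fun f => List.flatMap f _) (funext fun o => ?_)
    rw [List.flatMap_def, List.flatMap_def]
    exact congrArg _ (List.map_congr_left fun q hq => rowBits_regular hq k o.1 o.2 cl)

theorem rows_eq (cl : List RawClause) :
    (Kind.special.flatMap fun p => rowBits p 0 none [] [] cl) ++ clausesRowsBits cl [bot] cl =
      (records cl).flatMap fun r => (records cl).map (Rec.bit r) := by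
  have h := clausesRowsBits_eq cl cl 0
  rw [List.replicate_zero, List.nil_append] at h
  rw [h, records, List.flatMap_append, List.flatMap_map]
  congr 1
  rw [List.flatMap_def, List.flatMap_def]
  exact congrArg _ (List.map_congr_left fun q hq => rowBits_special hq cl [] [] 0 none)

/-- The bits written at the end of each literal when the centers are listed. -/
def centerBits (l : List Sym) : List Bool :=
  l.flatMap fun x => if x = none then Kind.regular.map Kind.center else []

theorem centerBits_word (l : RawLiteral) :
    centerBits (word l) = Kind.regular.map Kind.center := by
  have h : ∀ n, centerBits (List.replicate n one) = [] := by
    intro n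
    simp [centerBits, List.flatMap_eq_nil_iff]
  have h' : centerBits (word l) = centerBits (List.replicate l.1 one) ++ centerBits [none] := by
    simp [centerBits, word]
  rw [h', h]
  rfl

theorem centers_eq (cl : List RawClause) :
    Kind.special.map Kind.center ++ centerBits (clausesWord cl) =
      (records cl).map fun r => r.kind.center := by
  have h : ∀ k, centerBits (clausesWord cl) =
      ((cl.zipIdx k).flatMap fun x => block x.2 x.1).map fun r => r.kind.center := by
    induction cl with
    | nil => intro k; rfl
    | cons c cl ih =>
      intro k
      have h1 : centerBits (clausesWord (c :: cl)) =
          centerBits (word c.1) ++ (centerBits (word c.2.1) ++ (centerBits (word c.2.2) ++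
            centerBits (clausesWord cl))) := by
        simp [centerBits, clausesWord, clauseWord]
      rw [h1, ih (k + 1), List.zipIdx_cons, List.flatMap_cons, List.map_append]
      simp only [centerBits_word, block, RawClause.occs, List.flatMap_cons, List.flatMap_nil,
        List.map_append, List.map_map, List.append_nil, List.append_assoc]
      rfl
  rw [h 0, records, List.map_append, List.map_map]
  rfl

/-- Each literal ends with one separator, at which `distribute` writes six unary digits. With the
six of the special vertices this makes 6 + 18m. -/
theorem count_none_clausesWord (cl : List RawClause) :
    (clausesWord cl).count none = 3 * cl.length := by
  induction cl with
  | nil => rfl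
  | cons c cl ih =>
    have h : ∀ l : RawLiteral, (word l).count none = 1 := by
      intro l
      simp [word, List.count_replicate]
    have h' : clausesWord (c :: cl) = clauseWord c ++ clausesWord cl := rfl
    rw [h', List.count_append, ih, clauseWord, List.count_append, List.count_append, h, h, h,
      List.length_cons]
    ring

/-! ### The program for the reduction -/

/-- Copy the input to `inp` and `cols`, and write the number of vertices. -/
def distribute : Prog (Option Stk) :=
  loop (some .tmp) (fun _ => true) fun x =>
    seq (push (some .inp) x) <| seq (push (some .cols) x) <|
    if x = none then emit (some .rev) (List.replicate 6 true) else skip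

theorem does_distribute (l : List Sym) (m : Mem) (h : m.tmp = l) :
    Does distribute m
      { m with
        tmp := []
        inp := l.reverse ++ m.inp
        cols := l.reverse ++ m.cols
        rev := List.replicate (6 * l.count none) one ++ m.rev } (l.length + 1) := by
  induction l generalizing m with
  | nil =>
    refine (Does.loop_nil (k := some .tmp) h).of_eq ?_ (by simp)
    obtain ⟨⟩ := m
    simp_all
  | cons x l ih =>
    have h1 : Does (if x = none then emit (some .rev) (List.replicate 6 true) else skip)
        { m with tmp := l, inp := x :: m.inp, cols := x :: m.cols }
        { m with
          tmp := l
          inp := x :: m.inp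
          cols := x :: m.cols
          rev := List.replicate (6 * [x].count none) one ++ m.rev } 0 := by
      by_cases hx : x = none
      · subst hx
        exact (Does.emit (some .rev) (List.replicate 6 true) _)
      · rw [if_neg hx]
        refine (Does.skip _).of_eq ?_ le_rfl
        simp [hx]
    have h2 := (Does.push (some .inp) x { m with tmp := l }).seq
      ((Does.push (some .cols) x { m with tmp := l, inp := x :: m.inp }).seq h1)
    refine (Does.loop_cons (k := some .tmp) h rfl h2 (ih _ rfl)).of_eq ?_
      (by simp only [List.length_cons]; omega)
    have e : (x :: l).count none = l.count none + [x].count none := by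
      rw [← List.singleton_append, List.count_append, add_comm]
    rw [e, mul_add, List.replicate_add]
    simp only [List.reverse_cons, List.append_assoc, List.cons_append, List.nil_append]

/-- Write the bits telling the centers. -/
def listCenters : Prog (Option Stk) :=
  loop (some .cols) (fun _ => true) fun x =>
    if x = none then emit (some .rev) (Kind.regular.map Kind.center) else skip

theorem does_listCenters (l : List Sym) (m : Mem) (h : m.cols = l) :
    Does listCenters m
      { m with
        cols := []
        rev := ((centerBits l).map some).reverse ++ m.rev } (l.length + 1) := by
  induction l generalizing m with
  | nil =>
    refine (Does.loop_nil (k := some .cols) h).of_eq ?_ (by simp)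
    obtain ⟨⟩ := m
    simp_all [centerBits]
  | cons x l ih =>
    have h1 : Does (if x = none then emit (some .rev) (Kind.regular.map Kind.center) else skip)
        { m with cols := l }
        { m with
          cols := l
          rev := ((centerBits [x]).map some).reverse ++ m.rev } 0 := by
      by_cases hx : x = none
      · subst hx
        exact (Does.emit (some .rev) (Kind.regular.map Kind.center) _)
      · rw [if_neg hx]
        refine (Does.skip _).of_eq ?_ le_rfl
        simp [hx, centerBits]
    refine (Does.loop_cons (k := some .cols) h rfl h1 (ih _ rfl)).of_eq ?_
      (by simp only [List.length_cons]; omega)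
    have e : centerBits (x :: l) = centerBits [x] ++ centerBits l := by
      simp [centerBits]
    rw [e]
    simp

/-- The program computing the reduction. -/
def reductionProg : Prog (Option Stk) :=
  seq (loop (some .inp) Option.isSome fun _ => skip) <|
  seq (pour (some .inp) (some .tmp)) <|
  seq distribute <|
  seq (emit (some .rev) (List.replicate 6 true)) <|
  seq (push (some .rev) none) <|
  seq (seqs (Kind.special.map fun p => row p 0 none)) <|
  seq (push (some .idx) bot) <|
  seq (loop (some .inp) (fun _ => true) clauseRows) <|
  seq (emit (some .rev) (Kind.special.map Kind.center)) <|
  seq listCenters <|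
  seq (push (some .rev) none) <|
  seq (push (some .rev) one) <|
  seq (clear (some .idx)) (pour (some .rev) none)

theorem does_dropVars (n : ℕ) (rest : List Sym) (m : Mem)
    (h : m.inp = List.replicate n one ++ none :: rest) :
    Does (loop (some .inp) Option.isSome fun _ => skip) m { m with inp := rest } (n + 1) := by
  induction n generalizing m with
  | zero => exact (Does.loop_exit (k := some .inp) h rfl).of_eq rfl (by omega)
  | succ n ih =>
    exact (Does.loop_cons (k := some .inp) h rfl (Does.skip _)
      (ih { m with inp := List.replicate n one ++ none :: rest } rfl)).of_eq rfl (by omega)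

/-- A bound for the running time of the reduction. -/
def reductionTime (B : ℕ) : ℕ :=
  6 * rowTime B + B * (3 * (6 * rowTime B + 2 * B + 2) + 1) + (6 + 18 * B) ^ 2 + 41 * B + 25

/-- The word written by the reduction. -/
def outputWord (cl : List RawClause) : List Sym :=
  List.replicate (records cl).length (some true) ++ [none] ++
    (records cl).flatMap (fun u => (records cl).map fun v => some (u.bit v)) ++
    (records cl).map (fun v => some v.kind.center) ++ [none] ++ [some true]

theorem length_outputWord (cl : List RawClause) :
    (outputWord cl).length = (6 + 18 * cl.length) ^ 2 + 2 * (6 + 18 * cl.length) + 3 := by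
  simp [outputWord, List.length_flatMap, length_records]
  ring

/-- The unary number of variables is discarded, as the graph depends on the clauses only. The output
is built reversed on `rev`, and all stacks but the output are empty in the end, as a halting
configuration requires. -/
theorem does_reductionProg (n : ℕ) (cl : List RawClause) {B : ℕ}
    (hn : n + 1 + (clausesWord cl).length ≤ B)
    (hl : ∀ c ∈ cl, c.1.1 < B ∧ c.2.1.1 < B ∧ c.2.2.1 < B) (hB : cl.length + 1 ≤ B) :
    Does reductionProg
      ⟨[], List.replicate n one ++ none :: clausesWord cl, [], [], [], [], [], [], [], []⟩
      ⟨outputWord cl, [], [], [], [], [], [], [], [], []⟩ (reductionTime B) := by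
  have hle : (clausesWord cl).length ≤ B := by omega
  set e := clausesWord cl with he
  set r₁ := List.replicate (6 * (3 * cl.length)) one with hr₁
  set r₂ := none :: (List.replicate 6 one ++ r₁) with hr₂
  set b₁ := Kind.special.flatMap fun p => rowBits p 0 none [] [] cl with hb₁
  set r₃ := (b₁.map some).reverse ++ r₂ with hr₃
  set b₂ := clausesRowsBits cl [bot] cl with hb₂
  set r₄ := (b₂.map some).reverse ++ r₃ with hr₄
  set r₅ := ((Kind.special.map Kind.center).map some).reverse ++ r₄ with hr₅
  set r₆ := ((centerBits e).map some).reverse ++ r₅ with hr₆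
  have hr : (one :: none :: r₆).reverse = outputWord cl := by
    have o : outputWord cl = List.replicate (6 * (3 * cl.length) + 6) one ++ [none] ++
        (b₁ ++ b₂).map some ++ (Kind.special.map Kind.center ++ centerBits e).map some ++
        [none] ++ [one] := by
      rw [hb₁, hb₂, he, rows_eq, centers_eq, outputWord, length_records, List.map_flatMap,
        List.map_map, show 6 * (3 * cl.length) + 6 = 6 + 18 * cl.length by ring]
      simp only [List.map_map]
      rfl
    rw [o]
    simp [hr₆, hr₅, hr₄, hr₃, hr₂, hr₁, List.replicate_add]
  have h1 := does_dropVars n e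
    ⟨[], List.replicate n one ++ none :: e, [], [], [], [], [], [], [], []⟩ rfl
  have h2 := Does.pour (a := some .inp) (b := some .tmp) (by decide)
    ⟨[], e, [], [], [], [], [], [], [], []⟩
  have h3 := does_distribute e.reverse ⟨[], [], [], [], [], [], [], [], e.reverse, []⟩ rfl
  have h4 := Does.emit (some .rev) (List.replicate 6 true)
    ⟨[], e, e, [], [], [], [], [], [], r₁⟩
  have h5 := Does.push (some .rev) none
    ⟨[], e, e, [], [], [], [], [], [], List.replicate 6 one ++ r₁⟩
  have h6 := does_rows 0 none (B := B) (cl := cl) Kind.special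
    ⟨[], e, e, [], [], [], [], [], [], r₂⟩
    ⟨rfl, rfl, rfl, rfl, rfl, hl, by omega, hle⟩ (by simp) (by simp)
  have h7 := Does.push (some .idx) bot ⟨[], e, e, [], [], [], [], [], [], r₃⟩
  have h8 := does_rowLoop (B := B) (cl := cl) cl hl ⟨[], e, e, [], [], [], [bot], [], [], r₃⟩
    ⟨rfl, rfl, rfl, rfl, rfl, hl, by omega, hle⟩ rfl (by simp; omega) rfl
  have h9 := Does.emit (some .rev) (Kind.special.map Kind.center)
    ⟨[], [], e, [], [], [], List.replicate cl.length one ++ [bot], [], [], r₄⟩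
  have h10 := does_listCenters e
    ⟨[], [], e, [], [], [], List.replicate cl.length one ++ [bot], [], [], r₅⟩ rfl
  have h11 := Does.push (some .rev) none
    ⟨[], [], [], [], [], [], List.replicate cl.length one ++ [bot], [], [], r₆⟩
  have h12 := Does.push (some .rev) one
    ⟨[], [], [], [], [], [], List.replicate cl.length one ++ [bot], [], [], none :: r₆⟩
  have h13 := Does.clear (some .idx)
    ⟨[], [], [], [], [], [], List.replicate cl.length one ++ [bot], [], [], one :: none :: r₆⟩
  have h14 := Does.pour (a := some .rev) (b := none) (by decide)
    ⟨[], [], [], [], [], [], [], [], [], one :: none :: r₆⟩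
  rw [List.count_reverse, he, count_none_clausesWord, ← he] at h3
  simp only [Mem.fn, Mem.set, List.append_nil,
    List.reverse_reverse] at h1 h2 h3 h4 h5 h6 h7 h8 h9 h10 h11 h12 h13 h14
  rw [hr] at h14
  have hlen := congrArg List.length hr
  rw [List.length_reverse, length_outputWord] at hlen
  refine (h1.seq (h2.seq (h3.seq (h4.seq (h5.seq (h6.seq (h7.seq (h8.seq (h9.seq (h10.seq
    (h11.seq (h12.seq (h13.seq h14))))))))))))).of_eq rfl ?_
  rw [hlen]
  have e1 : cl.length * (3 * (6 * rowTime B + 2 * B + 2) + 1) ≤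
      B * (3 * (6 * rowTime B + 2 * B + 2) + 1) := Nat.mul_le_mul_right _ (by omega)
  have e2 : (6 + 18 * cl.length) ^ 2 ≤ (6 + 18 * B) ^ 2 :=
    Nat.pow_le_pow_left (by omega) 2
  simp only [List.length_reverse, List.length_append, List.length_replicate, List.length_cons,
    List.length_nil, reductionTime]
  have e3 : Kind.special.length = 6 := rfl
  rw [e3]
  omega

/-! ### The running time of the reduction -/

theorem encode_eq (φ : Formula) :
    φ.encode = List.replicate φ.numVars one ++ none :: clausesWord φ.raw := by
  simp only [Formula.encode, clausesWord, Formula.raw, List.flatMap_map, List.append_assoc,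
    List.singleton_append]
  rfl

theorem length_word (l : RawLiteral) : (word l).length = l.1 + 2 := by
  simp [word]

theorem length_le_length_clausesWord (cl : List RawClause) :
    cl.length ≤ (clausesWord cl).length := by
  induction cl with
  | nil => exact Nat.zero_le _
  | cons c cl ih =>
    have h : clausesWord (c :: cl) = clauseWord c ++ clausesWord cl := rfl
    rw [h, List.length_append, List.length_cons, clauseWord, List.length_append, length_word]
    omega

theorem length_clausesWord_le {n : ℕ} (cl : List RawClause)
    (hl : ∀ c ∈ cl, c.1.1 < n ∧ c.2.1.1 < n ∧ c.2.2.1 < n) :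
    (clausesWord cl).length ≤ 3 * (n + 1) * cl.length := by
  induction cl with
  | nil => exact Nat.zero_le _
  | cons c cl ih =>
    have h : clausesWord (c :: cl) = clauseWord c ++ clausesWord cl := rfl
    have h1 := hl c List.mem_cons_self
    have h2 := ih fun c hc => hl c (List.mem_cons_of_mem _ hc)
    rw [h, List.length_append, List.length_cons, clauseWord, List.length_append,
      List.length_append, length_word, length_word, length_word, mul_add]
    omega

theorem raw_lt (φ : Formula) :
    ∀ c ∈ φ.raw, c.1.1 < φ.numVars ∧ c.2.1.1 < φ.numVars ∧ c.2.2.1 < φ.numVars := by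
  intro c hc
  obtain ⟨d, -, rfl⟩ := List.mem_map.1 hc
  exact ⟨d.1.1.2, d.2.1.1.2, d.2.2.1.2⟩

theorem length_raw (φ : Formula) : φ.raw.length = φ.numClauses := List.length_map _

theorem length_encode_formula (φ : Formula) :
    φ.encode.length = φ.numVars + 1 + (clausesWord φ.raw).length := by
  rw [encode_eq, List.length_append, List.length_replicate, List.length_cons]
  ring

theorem length_encode_formula_le (φ : Formula) :
    φ.encode.length ≤ 3 * (φ.numVars + φ.numClauses + 1) ^ 2 := by
  have h := length_clausesWord_le φ.raw (raw_lt φ)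
  rw [length_raw] at h
  rw [length_encode_formula]
  nlinarith [Nat.zero_le φ.numVars, Nat.zero_le φ.numClauses]

theorem runs_reductionProg (φ : Formula) :
    ∃ t ≤ reductionTime φ.encode.length,
      Runs reductionProg (single (some .inp) φ.encode) (single none (reduction φ).encode) t := by
  have hB := length_encode_formula φ
  have hc := length_le_length_clausesWord φ.raw
  have h := does_reductionProg φ.numVars φ.raw hB.ge
    (fun c hc => by have := raw_lt φ c hc; omega) (by omega)
  rw [← encode_eq] at h
  have e1 : Mem.fn ⟨[], φ.encode, [], [], [], [], [], [], [], []⟩ =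
      single (some .inp) φ.encode := by
    funext k
    rcases k with _ | ⟨⟨⟩⟩ <;> rfl
  have e2 : Mem.fn ⟨outputWord φ.raw, [], [], [], [], [], [], [], [], []⟩ =
      single none (reduction φ).encode := by
    rw [reduction_encode]
    funext k
    rcases k with _ | ⟨⟨⟩⟩ <;> rfl
  rwa [Does, e1, e2] at h

open Polynomial in
/-- The bound for the running time of the machine computing the reduction. -/
noncomputable def timePoly : Polynomial ℕ :=
  6 * (12 * X ^ 2 + 17 * X + 5) + X * (3 * (6 * (12 * X ^ 2 + 17 * X + 5) + 2 * X + 2) + 1) +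
    (6 + 18 * X) ^ 2 + 41 * X + 25 + 1

theorem eval_timePoly (B : ℕ) : timePoly.eval B = reductionTime B + 1 := by
  simp [timePoly, reductionTime, rowTime]

/-- Cubic, since there are O(B) rows and each takes O(B²) loop tests. -/
theorem reductionTime_le (B : ℕ) : reductionTime B + 1 ≤ 1000 * (B + 1) ^ 3 := by
  unfold reductionTime rowTime
  nlinarith [Nat.zero_le B, Nat.zero_le (B ^ 2), Nat.zero_le (B ^ 3)]

end Prog

/-! ### Polynomial time and size of the reduction -/

theorem reduction_computable : Nonempty (Turing.TM2ComputableInPolyTime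
    Formula.encode Instance.encode reduction) := by
  have h : ∀ φ : Formula, Nonempty (Turing.TM2OutputsInTime
      (Prog.reductionProg.machine (some .inp) none).tm
      (φ.encode.map (Prog.reductionProg.machine (some .inp) none).inputAlphabet.invFun)
      (some ((reduction φ).encode.map
        (Prog.reductionProg.machine (some .inp) none).outputAlphabet.invFun))
      (Prog.timePoly.eval φ.encode.length)) := by
    intro φ
    obtain ⟨t, ht, hr⟩ := Prog.runs_reductionProg φ
    refine hr.machine_outputs ?_
    rw [Prog.eval_timePoly]
    omega
  exact ⟨⟨Prog.reductionProg.machine (some .inp) none, Prog.timePoly,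
    fun φ => Classical.choice (h φ)⟩⟩

theorem reduction_N (φ : Formula) : (reduction φ).N = 6 + 18 * φ.numClauses := by
  rw [← Prog.length_raw]
  exact length_records φ.raw

theorem length_reduction_encode (φ : Formula) : (reduction φ).encode.length =
    (6 + 18 * φ.numClauses) ^ 2 + 2 * (6 + 18 * φ.numClauses) + 3 := by
  rw [reduction_encode, ← Prog.length_raw]
  exact Prog.length_outputWord φ.raw

theorem length_reduction_encode_le (φ : Formula) :
    (reduction φ).encode.length ≤ 1000 * (φ.numVars + φ.numClauses + 1) ^ 2 := by
  rw [length_reduction_encode]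
  nlinarith [Nat.zero_le φ.numVars, Nat.zero_le φ.numClauses]

/-! ## Subexponential bounds -/

/-- The finitely many exceptional arguments are absorbed into a constant, which gives a bound at all
arguments and makes substitutions easy. -/
theorem isLittleO_natCast_iff {g : ℕ → ℝ} :
    g =o[atTop] (fun s : ℕ => (s : ℝ)) ↔ ∀ ε > 0, ∃ C, ∀ s : ℕ, |g s| ≤ ε * s + C := by
  rw [isLittleO_iff]
  simp only [Real.norm_eq_abs, Nat.abs_cast]
  constructor
  · intro h ε hε
    obtain ⟨N, hN⟩ := eventually_atTop.1 (h hε)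
    refine ⟨∑ i ∈ Finset.range N, |g i|, fun s => ?_⟩
    have h0 : 0 ≤ ∑ i ∈ Finset.range N, |g i| := Finset.sum_nonneg fun i _ => abs_nonneg _
    rcases le_or_gt N s with hs | hs
    · linarith [hN s hs]
    · have := Finset.single_le_sum (f := fun i => |g i|) (fun i _ => abs_nonneg _)
        (Finset.mem_range.2 hs)
      have h1 : 0 ≤ ε * s := by positivity
      linarith
  · intro h ε hε
    obtain ⟨C, hC⟩ := h (ε / 2) (half_pos hε)
    filter_upwards [tendsto_natCast_atTop_atTop.eventually_ge_atTop (C / (ε / 2))] with s hs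
    rw [div_le_iff₀ (half_pos hε)] at hs
    linarith [hC s]

theorem isLittleO_comp_affine {g : ℕ → ℝ} (hg : g =o[atTop] (fun s : ℕ => (s : ℝ))) (a b d : ℕ) :
    (fun m => g (a * (b + d * m))) =o[atTop] (fun s : ℕ => (s : ℝ)) := by
  rw [isLittleO_natCast_iff] at hg ⊢
  intro ε hε
  have hd : (0 : ℝ) < a * d + 1 := by positivity
  -- The summand 1 keeps the divisor positive when `a` or `d` is zero, which happens if f(1) = 0.
  obtain ⟨C, hC⟩ := hg (ε / (a * d + 1)) (by positivity)
  refine ⟨ε / (a * d + 1) * (a * b) + C, fun s => (hC _).trans ?_⟩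
  have h : ε / (a * d + 1) * (a * d) ≤ ε := by
    rw [div_mul_eq_mul_div, div_le_iff₀ hd]
    nlinarith
  have h' := mul_le_mul_of_nonneg_right h (Nat.cast_nonneg (α := ℝ) s)
  push_cast
  nlinarith

/-- A sublinear function has a sublinear monotone majorant. -/
theorem exists_isLittleO_majorant {g : ℕ → ℝ} (hg : g =o[atTop] (fun s : ℕ => (s : ℝ))) :
    ∃ G : ℕ → ℝ, G =o[atTop] (fun s : ℕ => (s : ℝ)) ∧ ∀ m s, m ≤ s → |g m| ≤ G s := by
  refine ⟨fun s => (Finset.range (s + 1)).sup' Finset.nonempty_range_add_one fun m => |g m|,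
    ?_, fun m s h => Finset.le_sup' (fun m => |g m|) (Finset.mem_range.2 (by omega))⟩
  rw [isLittleO_natCast_iff] at hg ⊢
  intro ε hε
  obtain ⟨C, hC⟩ := hg ε hε
  refine ⟨C, fun s => ?_⟩
  have h0 := Finset.le_sup' (fun m => |g m|) (Finset.mem_range.2 s.succ_pos)
  rw [abs_of_nonneg ((abs_nonneg _).trans h0)]
  refine Finset.sup'_le _ _ fun m hm => (hC m).trans ?_
  have : (m : ℝ) ≤ s := Nat.cast_le.2 (Nat.lt_succ_iff.1 (Finset.mem_range.1 hm))
  gcongr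

/-- Lets polynomial factors of the running time move into the exponent of 2. -/
theorem isLittleO_logb_polynomial {K : ℝ} (hK : 0 < K) (d : ℕ) :
    (fun s : ℕ => Real.logb 2 (K * ((s : ℝ) + 1) ^ d)) =o[atTop] (fun s : ℕ => (s : ℝ)) := by
  have h1 : (fun s : ℕ => Real.log ((s : ℝ) + 1)) =o[atTop] (fun s : ℕ => (s : ℝ)) := by
    have ht : Tendsto (fun s : ℕ => (s : ℝ) + 1) atTop atTop :=
      tendsto_atTop_add_const_right _ _ tendsto_natCast_atTop_atTop
    refine (Real.isLittleO_log_id_atTop.comp_tendsto ht).trans_isBigO ?_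
    refine IsBigO.of_bound 2 ?_
    filter_upwards [eventually_ge_atTop 1] with s hs
    have : (1 : ℝ) ≤ s := by exact_mod_cast hs
    simp only [Function.comp, id, Real.norm_eq_abs, Nat.abs_cast]
    rw [abs_of_nonneg (by positivity)]
    linarith
  have h2 : (fun _ : ℕ => Real.log K) =o[atTop] (fun s : ℕ => (s : ℝ)) :=
    isLittleO_const_left.2 (Or.inr (tendsto_norm_atTop_atTop.comp tendsto_natCast_atTop_atTop))
  refine ((h2.add (h1.const_mul_left d)).const_mul_left (Real.log 2)⁻¹).congr_left fun s => ?_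
  have hs : (0 : ℝ) < (s : ℝ) + 1 := by positivity
  rw [Real.logb, Real.log_mul hK.ne' (by positivity), Real.log_pow]
  ring

/-! ## The main results -/

theorem not_solvableInSubexpTime (hE : ETH) (f : ℕ → ℕ) : ¬ SolvableInSubexpTime f := by
  rintro ⟨g, c, hg, M, hM⟩
  -- The vertex count depends on m alone, whereas ETH speaks of n + m. As `g` need not be monotone,
  -- a monotone majorant is needed to pass from m to n + m.
  obtain ⟨G, hG, hgG⟩ := exists_isLittleO_majorant (isLittleO_comp_affine hg (f 1) 6 18)
  set K : ℝ := 128000 * 1000 ^ c with hK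
  -- The summand 1 doubles the bound, to cover both the reduction and the machine `M`. The constant
  -- `K` dominates 64000, from the cubic time on words of quadratic length, and 1000 ^ c, from the
  -- factor polynomial in the length of the instance; the exponents 6 and 2c arise likewise.
  refine hE ⟨fun s => G s + (1 + Real.logb 2 (K * ((s : ℝ) + 1) ^ (6 + 2 * c))),
    hG.add (IsLittleO.add ?_ (isLittleO_logb_polynomial (by positivity) _)),
    Prog.reductionProg.before .inp M, fun φ => ?_⟩
  · exact isLittleO_const_left.2
      (Or.inr (tendsto_norm_atTop_atTop.comp tendsto_natCast_atTop_atTop))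
  obtain ⟨t, ht, hr⟩ := Prog.runs_reductionProg φ
  obtain ⟨T, hT, ho⟩ := hM (reduction φ)
  refine ⟨t + 1 + T, ?_, ?_⟩
  · obtain ⟨s, hs⟩ : ∃ s, φ.numVars + φ.numClauses = s := ⟨_, rfl⟩
    obtain ⟨S, hS⟩ : ∃ S : ℝ, (s : ℝ) + 1 = S := ⟨_, rfl⟩
    have hS1 : 1 ≤ S := by simp [← hS]
    have hG0 : 0 ≤ G s := (abs_nonneg _).trans (hgG 0 s (Nat.zero_le _))
    have hG1 : (1 : ℝ) ≤ 2 ^ G s := Real.one_le_rpow one_le_two hG0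
    have hgs : g (f (reduction φ).k * (reduction φ).N) ≤ G s := by
      rw [reduction_N]
      exact (le_abs_self _).trans (hgG φ.numClauses s (hs ▸ Nat.le_add_left _ _))
    have hlen : ((reduction φ).encode.length : ℝ) ≤ 1000 * S ^ 2 := by
      have h := length_reduction_encode_le φ
      rw [hs] at h
      rw [← hS]
      exact_mod_cast h
    have h1 : (T : ℝ) ≤ 2 ^ G s * (K * S ^ (6 + 2 * c)) := by
      have h2 : ((reduction φ).encode.length : ℝ) ^ c ≤ (1000 * S ^ 2) ^ c := by gcongr
      have h3 : (1000 * S ^ 2) ^ c ≤ K * S ^ (6 + 2 * c) := by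
        rw [hK, mul_pow, ← pow_mul, mul_assoc]
        have h4 : S ^ (2 * c) ≤ S ^ (6 + 2 * c) := pow_le_pow_right₀ hS1 (by omega)
        have h5 : 0 ≤ 1000 ^ c * S ^ (2 * c) := by positivity
        have h6 : 1000 ^ c * S ^ (2 * c) ≤ 1000 ^ c * S ^ (6 + 2 * c) := by gcongr
        linarith
      exact hT.trans (mul_le_mul (Real.rpow_le_rpow_of_exponent_le one_le_two hgs)
        (h2.trans h3) (by positivity) (by positivity))
    have h2 : ((t + 1 : ℕ) : ℝ) ≤ 2 ^ G s * (K * S ^ (6 + 2 * c)) := by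
      have h3 : t + 1 ≤ 64000 * (s + 1) ^ 6 := by
        have h4 := Prog.length_encode_formula_le φ
        rw [hs] at h4
        have h5 : φ.encode.length + 1 ≤ 4 * (s + 1) ^ 2 := by
          have : 1 ≤ (s + 1) ^ 2 := Nat.one_le_pow _ _ (by omega)
          omega
        calc t + 1 ≤ 1000 * (φ.encode.length + 1) ^ 3 :=
              (Nat.add_le_add_right ht 1).trans (Prog.reductionTime_le _)
          _ ≤ 1000 * (4 * (s + 1) ^ 2) ^ 3 := by gcongr
          _ = 64000 * (s + 1) ^ 6 := by ring
      have h4 : ((t + 1 : ℕ) : ℝ) ≤ 64000 * S ^ 6 := by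
        rw [← hS]
        exact_mod_cast h3
      have h5 : 64000 * S ^ 6 ≤ K * S ^ (6 + 2 * c) := by
        have h6 : S ^ 6 ≤ S ^ (6 + 2 * c) := pow_le_pow_right₀ hS1 (by omega)
        have h7 : (64000 : ℝ) ≤ K := by
          have : (1 : ℝ) ≤ 1000 ^ c := one_le_pow₀ (by norm_num)
          rw [hK]
          linarith
        gcongr
      have h6 : 0 ≤ K * S ^ (6 + 2 * c) := by positivity
      nlinarith
    change _ ≤ (2 : ℝ) ^ (G (φ.numVars + φ.numClauses) + (1 + Real.logb 2
      (K * (((φ.numVars + φ.numClauses : ℕ) : ℝ) + 1) ^ (6 + 2 * c))))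
    rw [hs, hS, Real.rpow_add two_pos, Real.rpow_add two_pos, Real.rpow_one,
      Real.rpow_logb two_pos (by norm_num) (by positivity), Nat.cast_add]
    linarith
  · have e : @decide φ.IsSat (Classical.propDecidable _) =
        @decide (reduction φ).IsYes (Classical.propDecidable _) :=
      decide_eq_decide.2 (reduction_correct φ)
    rw [e]
    exact hr.before_outputs ho

end NonClash

theorem theorem2 :
    (NonClash.ETH → ∀ f : ℕ → ℕ, Computable f → ¬ NonClash.SolvableInSubexpTime f) ∧
    (∃ (r : NonClash.Formula → NonClash.Instance) (C : ℕ),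
      Nonempty (Turing.TM2ComputableInPolyTime
        NonClash.Formula.encode NonClash.Instance.encode r) ∧
      ∀ φ : NonClash.Formula,
        (r φ).k = 1 ∧
        (r φ).N ≤ C * (φ.numVars + φ.numClauses + 1) ∧
        (φ.IsSat ↔ (r φ).IsYes)) := by
  -- The constant 18 suffices because 6 + 18m ≤ 18(n + m + 1).
  refine ⟨fun hE f _ => NonClash.not_solvableInSubexpTime hE f, NonClash.reduction, 18,
    NonClash.reduction_computable, fun φ => ⟨rfl, ?_, NonClash.reduction_correct φ⟩⟩
  rw [NonClash.reduction_N]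
  omega
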